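/- Let $\mathcal X,\mathcal Y$ be infinite-dimensional (not necessarily separable) complex Hilbert spaces, with inner products linear in the second argument. Every compact operator $C:\mathcal X\to\mathcal Y$ has a Schmidt decomposition $C=\sum_{n\ge 1}s_n(C)\langle f_n,\cdot\rangle g_n$ (convergent in operator norm) with orthonormal systems $(f_n)_{n\in\mathbb N}$ in $\mathcal X$, $(g_n)_{n\in\mathbb N}$ in $\mathcal Y$ and a decreasing null sequence $(s_n(C))_{n\in\mathbb N}$ in $[0,\infty)$, the singular numbers of $C$, which is uniquely determined by $C$. For $p\in[1,\infty)$ let $\mathcal B^p(\mathcal X,\mathcal Y)$ be the set of compact operators $C$ with $\sum_n s_n(C)^p<\infty$, and let $\mathcal B^\infty(\mathcal X,\mathcal Y)$ be the set of all compact operators. The trace of $A\in\mathcal B^1(\mathcal Y,\mathcal Y)$ is $\operatorname{tr}(A)=\sum_{i}\langle b_i,Ab_i\rangle$ for any orthonormal basis $(b_i)_i$ of $\mathcal Y$. Write $\mathcal U(\mathcal X)$, $\mathcal U(\mathcal Y)$ for the groups of unitary operators. Theorem. Let $p,q\in[1,\infty]$ with $\frac1p+\frac1q=1$, let $C\in\mathcal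 B^p(\mathcal X,\mathcal Y)$ and $T\in\mathcal B^q(\mathcal Y,\mathcal X)$. Then for all $U\in\mathcal U(\mathcal X)$, $V\in\mathcal U(\mathcal Y)$ the operator $CUTV$ belongs to $\mathcal B^1(\mathcal Y,\mathcal Y)$ (so that its trace is well defined, independently of the orthonormal basis), the series $r:=\sum_{j=1}^\infty s_j(C)s_j(T)$ converges, and $$\sup_{U\in\mathcal U(\mathcal X),\,V\in\mathcal U(\mathcal Y)}|\operatorname{tr}(CUTV)|=\sum_{j=1}^\infty s_j(C)s_j(T).$$ Moreover, the closure of $S_C(T)=\{\operatorname{tr}(CUTV)\mid U\in\mathcal U(\mathcal X),\,V\in\mathcal U(\mathcal Y)\}$ is the closed disk $\{z\in\mathbb C\mid |z|\le r\}$. The supremum need not be attained: on $\ell_2(\mathbb N)$ with standard basis $(e_j)_{j\ge1}$, for the trace-class operator $C=\sum_{j\ge1}2^{-j}\langle e_j,\cdot\rangle e_j$ and the compact operator $T=\sum_{k\ge1}2^{-k}\langle e_{k+1},\cdot\rangle e_{k+1}$, one has $|\operatorname{tr}(CUTV)|\ne\sum_{j}s_j(C)s_j(T)$ for all unitary $U,V$.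 -/

import Mathlib

open scoped ENNReal InnerProductSpace lp
open Filter Topology

universe u v

namespace SchattenTrace

section

variable {X Y : Type*} [NormedAddCommGroup X] [InnerProductSpace ℂ X]
  [NormedAddCommGroup Y] [InnerProductSpace ℂ Y]

/-- A Schmidt decomposition of `C : X → Y`: a decreasing null sequence `s` in `[0, ∞)` and
orthonormal systems `f` in `X`, `g` in `Y` with `C = ∑ n, s n ⟨f n, ·⟩ g n`, the series converging
in operator norm. Indices start at `0`. -/
structure IsSchmidtDecomposition (C : X →L[ℂ] Y) (s : ℕ → ℝ) (f : ℕ → X) (g : ℕ → Y) : Prop where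
  nonneg : ∀ n, 0 ≤ s n
  antitone : Antitone s
  tendsto_zero : Tendsto s atTop (𝓝 0)
  orthonormal_left : Orthonormal ℂ f
  orthonormal_right : Orthonormal ℂ g
  tendsto_sum : Tendsto
    (fun N => ∑ n ∈ Finset.range N, (s n : ℂ) • InnerProductSpace.rankOne ℂ (g n) (f n))
    atTop (𝓝 C)

theorem IsSchmidtDecomposition.tendsto_apply {C : X →L[ℂ] Y} {s : ℕ → ℝ} {f : ℕ → X} {g : ℕ → Y}
    (h : IsSchmidtDecomposition C s f g) (x : X) :
    Tendsto (fun N => ∑ n ∈ Finset.range N, ((s n : ℂ) * ⟪f n, x⟫_ℂ) • g n) atTop (𝓝 (C x)) := by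
  have h1 := ((ContinuousLinearMap.apply ℂ Y x).continuous.tendsto C).comp h.tendsto_sum
  refine h1.congr fun N => ?_
  simp [mul_smul]

theorem IsSchmidtDecomposition.tendsto_norm_sq {C : X →L[ℂ] Y} {s : ℕ → ℝ} {f : ℕ → X}
    {g : ℕ → Y} (h : IsSchmidtDecomposition C s f g) (x : X) :
    Tendsto (fun N => ∑ n ∈ Finset.range N, s n ^ 2 * ‖⟪f n, x⟫_ℂ‖ ^ 2) atTop
      (𝓝 (‖C x‖ ^ 2)) := by
  refine ((h.tendsto_apply x).norm.pow 2).congr fun N => ?_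
  have h1 := h.orthonormal_right.inner_sum (fun n => (s n : ℂ) * ⟪f n, x⟫_ℂ)
    (fun n => (s n : ℂ) * ⟪f n, x⟫_ℂ) (Finset.range N)
  rw [inner_self_eq_norm_sq_to_K] at h1
  have h2 : ∀ n, (starRingEnd ℂ) ((s n : ℂ) * ⟪f n, x⟫_ℂ) * ((s n : ℂ) * ⟪f n, x⟫_ℂ) =
      ((s n ^ 2 * ‖⟪f n, x⟫_ℂ‖ ^ 2 : ℝ) : ℂ) := fun n => by
    rw [Complex.conj_mul', norm_mul, Complex.norm_real, Real.norm_eq_abs, ← Complex.ofReal_pow,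
      mul_pow, sq_abs]
  simp_rw [h2] at h1
  apply Complex.ofReal_injective
  push_cast at h1 ⊢
  exact h1

theorem IsSchmidtDecomposition.le {C : X →L[ℂ] Y} {s s' : ℕ → ℝ} {f f' : ℕ → X} {g g' : ℕ → Y}
    (h : IsSchmidtDecomposition C s f g) (h' : IsSchmidtDecomposition C s' f' g') (n : ℕ) :
    s n ≤ s' n := by
  -- a nonzero vector in the span of `f 0, …, f n` that is orthogonal to `f' 0, …, f' (n - 1)`
  let L : (Fin (n + 1) → ℂ) →ₗ[ℂ] (Fin n → ℂ) :=
    LinearMap.pi fun j => ∑ i : Fin (n + 1), ⟪f' j, f i⟫_ℂ • LinearMap.proj i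
  obtain ⟨c, hc, hc0⟩ := (Submodule.ne_bot_iff _).1
    (LinearMap.ker_ne_bot_of_finrank_lt (f := L) (by simp))
  let d : ℕ → ℂ := fun i => if hi : i < n + 1 then c ⟨i, hi⟩ else 0
  have hd : ∀ i : Fin (n + 1), d i = c i := fun i => dif_pos i.2
  let x : X := ∑ i ∈ Finset.range (n + 1), d i • f i
  have hx' : ∀ j < n, ⟪f' j, x⟫_ℂ = 0 := fun j hj => by
    have h1 := congrFun (LinearMap.mem_ker.1 hc) ⟨j, hj⟩
    simp only [x, inner_sum, inner_smul_right, Finset.sum_range, hd]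
    simpa [L, mul_comm] using h1
  have hxi : ∀ i < n + 1, ⟪f i, x⟫_ℂ = d i := fun i hi =>
    h.orthonormal_left.inner_right_sum d (Finset.mem_range.2 hi)
  have hxn : ‖x‖ ^ 2 = ∑ i ∈ Finset.range (n + 1), ‖d i‖ ^ 2 := by
    have h1 := h.orthonormal_left.inner_sum d d (Finset.range (n + 1))
    rw [show (∑ i ∈ Finset.range (n + 1), d i • f i) = x from rfl,
      inner_self_eq_norm_sq_to_K] at h1
    simp_rw [Complex.conj_mul'] at h1
    apply Complex.ofReal_injective
    push_cast
    exact h1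
  have hx0 : 0 < ‖x‖ ^ 2 := by
    obtain ⟨i, hi⟩ := Function.ne_iff.1 hc0
    rw [hxn]
    refine Finset.sum_pos' (fun _ _ => by positivity) ⟨i, Finset.mem_range.2 i.2, ?_⟩
    rw [hd]
    have : 0 < ‖c i‖ := norm_pos_iff.2 hi
    positivity
  have hlow : s n ^ 2 * ‖x‖ ^ 2 ≤ ‖C x‖ ^ 2 := by
    refine ge_of_tendsto (h.tendsto_norm_sq x) ?_
    filter_upwards [eventually_ge_atTop (n + 1)] with N hN
    calc s n ^ 2 * ‖x‖ ^ 2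
        = ∑ i ∈ Finset.range (n + 1), s n ^ 2 * ‖d i‖ ^ 2 := by rw [hxn, Finset.mul_sum]
      _ ≤ ∑ i ∈ Finset.range (n + 1), s i ^ 2 * ‖⟪f i, x⟫_ℂ‖ ^ 2 := by
          refine Finset.sum_le_sum fun i hi => ?_
          have hi := Finset.mem_range.1 hi
          rw [hxi i hi]
          have := pow_le_pow_left₀ (h.nonneg n) (h.antitone (Nat.lt_succ_iff.1 hi)) 2
          gcongr
      _ ≤ _ := Finset.sum_le_sum_of_subset_of_nonneg (Finset.range_mono hN)
          fun _ _ _ => by positivity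
  have hup : ‖C x‖ ^ 2 ≤ s' n ^ 2 * ‖x‖ ^ 2 := by
    refine le_of_tendsto' (h'.tendsto_norm_sq x) fun N => ?_
    calc ∑ i ∈ Finset.range N, s' i ^ 2 * ‖⟪f' i, x⟫_ℂ‖ ^ 2
        ≤ ∑ i ∈ Finset.range N, s' n ^ 2 * ‖⟪f' i, x⟫_ℂ‖ ^ 2 := by
          refine Finset.sum_le_sum fun i _ => ?_
          rcases lt_or_ge i n with hi | hi
          · simp [hx' i hi]
          · have := pow_le_pow_left₀ (h'.nonneg i) (h'.antitone hi) 2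
            gcongr
      _ = s' n ^ 2 * ∑ i ∈ Finset.range N, ‖⟪f' i, x⟫_ℂ‖ ^ 2 := by rw [Finset.mul_sum]
      _ ≤ _ := by
          gcongr
          exact h'.orthonormal_left.sum_inner_products_le x
  have h3 := le_of_mul_le_mul_right (hlow.trans hup) hx0
  exact le_of_sq_le_sq h3 (h'.nonneg n)

/-- The sequence in a Schmidt decomposition is determined by the operator. -/
theorem IsSchmidtDecomposition.unique {C : X →L[ℂ] Y} {s s' : ℕ → ℝ} {f f' : ℕ → X}
    {g g' : ℕ → Y} (h : IsSchmidtDecomposition C s f g)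
    (h' : IsSchmidtDecomposition C s' f' g') : s = s' :=
  funext fun n => le_antisymm (h.le h' n) (h'.le h n)

open Classical in
/-- The singular numbers `s_0(C) ≥ s_1(C) ≥ …` of `C`: the sequence occurring in a Schmidt
decomposition of `C`. (Operators without one, in particular all noncompact operators, get the
value `0`, which is never used.) -/
noncomputable def singularNumber (C : X →L[ℂ] Y) : ℕ → ℝ :=
  if h : ∃ s f g, IsSchmidtDecomposition C s f g then h.choose else 0

theorem IsSchmidtDecomposition.singularNumber_eq {C : X →L[ℂ] Y} {s : ℕ → ℝ} {f : ℕ → X}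
    {g : ℕ → Y} (h : IsSchmidtDecomposition C s f g) : singularNumber C = s := by
  have hex : ∃ s f g, IsSchmidtDecomposition C s f g := ⟨s, f, g, h⟩
  obtain ⟨f', g', h'⟩ := hex.choose_spec
  rw [singularNumber, dif_pos hex]
  exact h'.unique h

/-- The `p`-th Schatten class for `p ∈ [1, ∞]`: compact operators whose singular numbers are
`p`-summable. For `p = ∞` the condition is boundedness of the (null) sequence of singular
numbers, so that this is the set of all compact operators. -/
def IsSchattenClass (p : ℝ≥0∞) (C : X →L[ℂ] Y) : Prop :=
  IsCompactOperator C ∧ Memℓp (singularNumber C) p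

/-- The trace `∑ i, ⟨b i, A (b i)⟩` of `A`, computed in some orthonormal basis `b`. It is
meaningful for trace-class operators `A`, for which the choice of `b` is immaterial. -/
noncomputable def trace [CompleteSpace X] (A : X →L[ℂ] X) : ℂ :=
  ∑' i, ⟪(exists_hilbertBasis ℂ X).choose_spec.choose i,
    A ((exists_hilbertBasis ℂ X).choose_spec.choose i)⟫_ℂ

/-- The set `S_C(T) = {tr (C U T V) | U unitary on X, V unitary on Y}`. -/
def traceRange [CompleteSpace X] [CompleteSpace Y] (C : X →L[ℂ] Y) (T : Y →L[ℂ] X) : Set ℂ :=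
  {z | ∃ (U : unitary (X →L[ℂ] X)) (V : unitary (Y →L[ℂ] Y)),
    z = trace (C ∘L (U : X →L[ℂ] X) ∘L T ∘L (V : Y →L[ℂ] Y))}

end

end SchattenTrace

/-!
The key estimate is the trace inequality of von Neumann. Let `C = ∑ s n ⟨f n, ·⟩ g n` and
`T = ∑ t k ⟨h k, ·⟩ e k` be Schmidt decompositions, let `U` be unitary, and let `ψ`, `χ` be
orthonormal systems with finitely many members. For truncations of `C` and `T` to finite rank,
`∑ i, ⟨ψ i, C U T χ i⟩` equals
`∑ n k, s n * t k * ⟨f n, U e k⟩ * ⟨h k, D g n⟩` with the contraction `D = ∑ i, ⟨ψ i, ·⟩ χ i`. By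
`|a b| ≤ (|a|² + |b|²) / 2` and Bessel's inequality it is dominated by the mean of two sums
`∑ n k, s n * t k * α n k` with doubly substochastic matrices `α`, and each of these is at most
`∑ j, s j * t j` (`sum_sum_mul_le_of_substochastic`, by summation by parts). The estimate is recorded
in `IsSchmidtDecomposition.norm_sum_inner_le_sub` together with a loss term for mass missing from the
first matrix.

Applied to a Schmidt decomposition of `C U T V`, which exists because this operator is compact
(`exists_isSchmidtDecomposition`), the inequality shows that its singular numbers have sum at most
`r = ∑ j, s j * t j`. Hence `C U T V` is of trace class, and its trace is independent of the
orthonormal basis and bounded by `r`.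

For the converse let `|z| ≤ 1` and `N` be given. Since a map between finite orthonormal families
extends to a unitary operator, there are `U` and `V` with `U e n = f n` and
`V g n = z h n + √(1 - |z|²) h (N + n)` for `n < N`. Then `tr (C U T V)` is `z ∑ n < N, s n * t n`
plus the trace of the corresponding operator for the tails of the two decompositions, which is at
most `∑ j ≥ N, s j * t j` by the same inequality
(`IsSchmidtDecomposition.exists_norm_trace_sub_le`). So every point of the disk of radius `r` is a
limit of traces; in particular the supremum of their absolute values is `r`.

In the counterexample, the matrix `‖⟨b n, U b (k + 1)⟩‖²` omits the column of the vector `U b 0`,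
which is not zero. Some row is therefore not stochastic, and the loss term is positive because `s` is
strictly decreasing and `t` is positive (`norm_trace_ne_of_missing_vector`).
-/

namespace SchattenTrace

/-! ### Doubly substochastic matrices and decreasing sequences -/

/-- Weighting a decreasing sequence by numbers in `[0, 1]` of total mass at most `m` gives at most
the sum of its first `m` terms, and every unit of mass that is missing costs at least `t m`. -/
theorem sum_mul_le_sum_sub {t β : ℕ → ℝ} (ht : Antitone t) {m N : ℕ} (hmN : m ≤ N)
    (hβ0 : ∀ k, 0 ≤ β k) (hβ1 : ∀ k, β k ≤ 1) :
    ∑ k ∈ Finset.range N, t k * β k ≤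
      ∑ k ∈ Finset.range m, t k - t m * (m - ∑ k ∈ Finset.range N, β k) := by
  have h1 : ∑ k ∈ Finset.range N, (t k - t m) * β k ≤ ∑ k ∈ Finset.range m, (t k - t m) := by
    rw [← Finset.sum_range_add_sum_Ico _ hmN]
    have h2 : ∑ k ∈ Finset.Ico m N, (t k - t m) * β k ≤ 0 :=
      Finset.sum_nonpos fun k hk => mul_nonpos_of_nonpos_of_nonneg
        (sub_nonpos.2 (ht (Finset.mem_Ico.1 hk).1)) (hβ0 k)
    have h3 : ∑ k ∈ Finset.range m, (t k - t m) * β k ≤ ∑ k ∈ Finset.range m, (t k - t m) :=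
      Finset.sum_le_sum fun k hk => mul_le_of_le_one_right
        (sub_nonneg.2 (ht (Finset.mem_range.1 hk).le)) (hβ1 k)
    linarith
  simp only [sub_mul, Finset.sum_sub_distrib, ← Finset.mul_sum, Finset.sum_const,
    Finset.card_range, nsmul_eq_mul] at h1
  linarith

/-- Summation by parts against the partial sums `∑ n < j, d n`. -/
theorem sum_mul_eq_sum_sub_mul_sum (s d : ℕ → ℝ) (N : ℕ) :
    ∑ n ∈ Finset.range N, s n * d n = s N * ∑ n ∈ Finset.range N, d n +
      ∑ i ∈ Finset.range N, (s i - s (i + 1)) * ∑ n ∈ Finset.range (i + 1), d n := by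
  induction N with
  | zero => simp
  | succ N ih =>
    rw [Finset.sum_range_succ, ih, Finset.sum_range_succ (fun i => (s i - s (i + 1)) * _) N,
      Finset.sum_range_succ d N]
    ring

/-- The rearrangement inequality for a doubly substochastic matrix `α`, with the loss that results
from the mass missing in the rows `0, …, m`. -/
theorem sum_sum_mul_le_of_substochastic {s t : ℕ → ℝ} {α : ℕ → ℕ → ℝ} (hs : Antitone s)
    (hs0 : ∀ n, 0 ≤ s n) (ht : Antitone t) (ht0 : ∀ n, 0 ≤ t n) {m N : ℕ} (hmN : m < N)
    (hα : ∀ n k, 0 ≤ α n k) (hrow : ∀ n, ∑ k ∈ Finset.range N, α n k ≤ 1)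
    (hcol : ∀ j k, ∑ n ∈ Finset.range j, α n k ≤ 1) :
    ∑ n ∈ Finset.range N, ∑ k ∈ Finset.range N, s n * t k * α n k ≤
      ∑ j ∈ Finset.range N, s j * t j - (s m - s (m + 1)) * (t (m + 1) *
        ((m + 1 : ℕ) - ∑ n ∈ Finset.range (m + 1), ∑ k ∈ Finset.range N, α n k)) := by
  have hD : ∀ j ≤ N, t j * (j - ∑ n ∈ Finset.range j, ∑ k ∈ Finset.range N, α n k) ≤
      ∑ n ∈ Finset.range j, (t n - ∑ k ∈ Finset.range N, t k * α n k) := fun j hj => by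
    have h1 := sum_mul_le_sum_sub (β := fun k => ∑ n ∈ Finset.range j, α n k) ht hj
      (fun k => Finset.sum_nonneg fun n _ => hα n k) (hcol j)
    rw [Finset.sum_comm] at h1
    simp only [Finset.mul_sum] at h1
    rw [Finset.sum_comm] at h1
    rw [Finset.sum_sub_distrib]
    linarith
  have hD0 : ∀ j ≤ N, 0 ≤ ∑ n ∈ Finset.range j, (t n - ∑ k ∈ Finset.range N, t k * α n k) :=
    fun j hj => le_trans (mul_nonneg (ht0 j) (sub_nonneg.2 ((Finset.sum_le_sum fun n _ =>
      hrow n).trans (by simp)))) (hD j hj)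
  have h2 := sum_mul_eq_sum_sub_mul_sum s
    (fun n => t n - ∑ k ∈ Finset.range N, t k * α n k) N
  have h3 : ∀ i, 0 ≤ s i - s (i + 1) := fun i => sub_nonneg.2 (hs i.le_succ)
  have h4 := Finset.single_le_sum (f := fun i => (s i - s (i + 1)) *
      ∑ n ∈ Finset.range (i + 1), (t n - ∑ k ∈ Finset.range N, t k * α n k))
    (fun i hi => mul_nonneg (h3 i) (hD0 (i + 1) (Finset.mem_range.1 hi))) (Finset.mem_range.2 hmN)
  have h5 := mul_le_mul_of_nonneg_left (hD (m + 1) hmN) (h3 m)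
  have h6 := mul_nonneg (hs0 N) (hD0 N le_rfl)
  have h7 : ∑ n ∈ Finset.range N, s n * (t n - ∑ k ∈ Finset.range N, t k * α n k) =
      ∑ j ∈ Finset.range N, s j * t j -
        ∑ n ∈ Finset.range N, ∑ k ∈ Finset.range N, s n * t k * α n k := by
    simp only [mul_sub, Finset.sum_sub_distrib, Finset.mul_sum, mul_assoc]
  linarith

/-! ### Existence of Schmidt decompositions -/

/-- In an infinite-dimensional space, finitely many vectors have a common orthogonal unit
vector. -/
theorem exists_norm_one_inner_eq_zero {X : Type*} [NormedAddCommGroup X]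
    [InnerProductSpace ℂ X] (hX : ¬ FiniteDimensional ℂ X) (f : ℕ → X) (n : ℕ) :
    ∃ x : X, ‖x‖ = 1 ∧ ∀ i < n, ⟪f i, x⟫_ℂ = 0 := by
  let S : Submodule ℂ X := Submodule.span ℂ (f '' Set.Iio n)
  have : FiniteDimensional ℂ S := FiniteDimensional.span_of_finite ℂ ((Set.finite_Iio n).image f)
  have hS : Sᗮ ≠ ⊥ := fun h => by
    rw [Submodule.orthogonal_eq_bot_iff] at h
    apply hX
    have : FiniteDimensional ℂ (⊤ : Submodule ℂ X) := h ▸ ‹FiniteDimensional ℂ S›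
    exact Submodule.topEquiv.finiteDimensional
  obtain ⟨x, hx, hx0⟩ := (Submodule.ne_bot_iff _).1 hS
  refine ⟨((‖x‖ : ℂ)⁻¹) • x, norm_smul_inv_norm hx0, fun i hi => ?_⟩
  have hfi : f i ∈ S := Submodule.subset_span ⟨i, hi, rfl⟩
  rw [inner_smul_right, Submodule.inner_right_of_mem_orthogonal hfi hx, mul_zero]

section Existence

variable {X : Type u} {Y : Type v} [NormedAddCommGroup X] [InnerProductSpace ℂ X]
  [CompleteSpace X] [NormedAddCommGroup Y] [InnerProductSpace ℂ Y] [CompleteSpace Y]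

open ContinuousLinearMap in
/-- A nonzero compact operator attains its norm, at an eigenvector of `C† C`. A maximizing sequence `x n` is asymptotically an
eigenvector: `‖C† C x - ‖C‖² x‖² ≤ 2 ‖C‖⁴ - 2 ‖C‖² ‖C x‖²`, so that it converges along a
subsequence for which `C† C (x n)` converges. -/
theorem exists_norm_one_adjoint_apply_eq {C : X →L[ℂ] Y} (hC : IsCompactOperator C)
    (h0 : C ≠ 0) : ∃ x : X, ‖x‖ = 1 ∧ adjoint C (C x) = ((‖C‖ ^ 2 : ℝ) : ℂ) • x := by
  have hpos : 0 < ‖C‖ := norm_pos_iff.2 h0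
  have hne : ((‖C‖ ^ 2 : ℝ) : ℂ) ≠ 0 := by exact_mod_cast (pow_pos hpos 2).ne'
  have hex : ∀ n : ℕ, ∃ x : X, ‖x‖ = 1 ∧ ‖C‖ - 1 / ((n : ℝ) + 1) < ‖C x‖ := by
    intro n
    by_contra! hcon
    have hle : ‖C‖ ≤ max (‖C‖ - 1 / ((n : ℝ) + 1)) 0 := by
      refine C.opNorm_le_of_unit_norm (le_max_right _ _) fun x hx => ?_
      exact (hcon x hx).trans (le_max_left _ _)
    have : 0 < 1 / ((n : ℝ) + 1) := by positivity
    rcases le_max_iff.1 hle with h | h <;> linarith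
  choose x hx1 hx using hex
  have hxC : Tendsto (fun n => ‖C (x n)‖) atTop (𝓝 ‖C‖) := by
    refine tendsto_of_tendsto_of_tendsto_of_le_of_le
      (by simpa using tendsto_const_nhds.sub (tendsto_one_div_add_atTop_nhds_zero_nat (𝕜 := ℝ)))
      tendsto_const_nhds (fun n => (hx n).le) fun n => ?_
    simpa [hx1] using C.le_opNorm (x n)
  have hK : IsCompactOperator (adjoint C ∘L C) := hC.clm_comp (adjoint C)
  obtain ⟨K, hKc, hKs⟩ := hK.image_closedBall_subset_compact (𝕜₁ := ℂ) 1
  obtain ⟨y, -, φ, hφ, hy⟩ := hKc.tendsto_subseq (x := fun n => adjoint C (C (x n)))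
    fun n => hKs ⟨x n, by simp [hx1], rfl⟩
  have hdiff : Tendsto (fun n => adjoint C (C (x n)) - ((‖C‖ ^ 2 : ℝ) : ℂ) • x n) atTop
      (𝓝 0) := by
    have h1 : Tendsto (fun n => 2 * ‖C‖ ^ 4 - 2 * ‖C‖ ^ 2 * ‖C (x n)‖ ^ 2) atTop (𝓝 0) := by
      have := ((hxC.pow 2).const_mul (2 * ‖C‖ ^ 2)).const_sub (2 * ‖C‖ ^ 4)
      convert this using 2
      ring
    have h2 : ∀ n, ‖adjoint C (C (x n)) - ((‖C‖ ^ 2 : ℝ) : ℂ) • x n‖ ^ 2 ≤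
        2 * ‖C‖ ^ 4 - 2 * ‖C‖ ^ 2 * ‖C (x n)‖ ^ 2 := by
      intro n
      rw [@norm_sub_sq ℂ, inner_smul_right, adjoint_inner_left, inner_self_eq_norm_sq_to_K,
        norm_smul, hx1]
      have h3 : ‖adjoint C (C (x n))‖ ≤ ‖C‖ * ‖C‖ := by
        refine ((adjoint C).le_opNorm _).trans ?_
        rw [LinearIsometryEquiv.norm_map]
        gcongr
        simpa [hx1] using C.le_opNorm (x n)
      have h4 : RCLike.re (((‖C‖ ^ 2 : ℝ) : ℂ) * ((‖C (x n)‖ : ℝ) : ℂ) ^ 2) =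
          ‖C‖ ^ 2 * ‖C (x n)‖ ^ 2 := by
        rw [← Complex.ofReal_pow, ← Complex.ofReal_mul]
        rfl
      have h5 := pow_le_pow_left₀ (norm_nonneg _) h3 2
      have h6 : ‖((‖C‖ ^ 2 : ℝ) : ℂ)‖ = ‖C‖ ^ 2 := by simp
      rw [h6]
      erw [h4]
      nlinarith
    have h7 := squeeze_zero (fun n => by positivity) h2 h1
    have h8 := h7.sqrt
    simp only [Real.sqrt_sq (norm_nonneg _), Real.sqrt_zero] at h8
    exact tendsto_zero_iff_norm_tendsto_zero.2 h8
  have hxl : Tendsto (fun n => x (φ n)) atTop (𝓝 (((‖C‖ ^ 2 : ℝ) : ℂ)⁻¹ • y)) := by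
    have h1 := (hy.sub (hdiff.comp hφ.tendsto_atTop)).const_smul (((‖C‖ ^ 2 : ℝ) : ℂ)⁻¹)
    simp only [Function.comp_def, sub_sub_cancel, sub_zero, inv_smul_smul₀ hne] at h1
    exact h1
  refine ⟨((‖C‖ ^ 2 : ℝ) : ℂ)⁻¹ • y, ?_, ?_⟩
  · exact tendsto_nhds_unique hxl.norm (by simp [hx1])
  · rw [smul_inv_smul₀ hne]
    exact tendsto_nhds_unique (((adjoint C ∘L C).continuous.tendsto _).comp hxl) hy

open ContinuousLinearMap in
/-- A leading pair of singular vectors of a compact operator that vanishes on `f 0, …, f (n - 1)`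
and whose adjoint vanishes on `g 0, …, g (n - 1)`, chosen orthogonal to these vectors. For the zero
operator this is where infinite dimension is needed. -/
theorem exists_singular_pair (hX : ¬ FiniteDimensional ℂ X) (hY : ¬ FiniteDimensional ℂ Y)
    {C : X →L[ℂ] Y} (hC : IsCompactOperator C) (f : ℕ → X) (g : ℕ → Y) (n : ℕ)
    (hf : ∀ i < n, C (f i) = 0) (hg : ∀ i < n, adjoint C (g i) = 0) :
    ∃ (x : X) (y : Y), ‖x‖ = 1 ∧ ‖y‖ = 1 ∧ C x = (‖C‖ : ℂ) • y ∧
      adjoint C y = (‖C‖ : ℂ) • x ∧ (∀ i < n, ⟪f i, x⟫_ℂ = 0) ∧ ∀ i < n, ⟪g i, y⟫_ℂ = 0 := by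
  by_cases h0 : C = 0
  · obtain ⟨x, hx, hx'⟩ := exists_norm_one_inner_eq_zero hX f n
    obtain ⟨y, hy, hy'⟩ := exists_norm_one_inner_eq_zero hY g n
    exact ⟨x, y, hx, hy, by simp [h0], by simp [h0], hx', hy'⟩
  obtain ⟨x, hx, hx'⟩ := exists_norm_one_adjoint_apply_eq hC h0
  have hne : (‖C‖ : ℂ) ≠ 0 := by exact_mod_cast (norm_pos_iff.2 h0).ne'
  have hCx : C x = (‖C‖ : ℂ) • ((‖C‖ : ℂ)⁻¹ • C x) := (smul_inv_smul₀ hne _).symm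
  have hay : adjoint C ((‖C‖ : ℂ)⁻¹ • C x) = (‖C‖ : ℂ) • x := by
    rw [map_smul, hx', smul_smul]
    congr 1
    push_cast
    field_simp
  refine ⟨x, (‖C‖ : ℂ)⁻¹ • C x, hx, ?_, hCx, hay, fun i hi => ?_, fun i hi => ?_⟩
  · have h1 : ((‖C x‖ : ℝ) : ℂ) ^ 2 = (‖C‖ : ℂ) ^ 2 := by
      have h2 := inner_self_eq_norm_sq_to_K (𝕜 := ℂ) (C x)
      rw [← adjoint_inner_left, hx', inner_smul_left, inner_self_eq_norm_sq_to_K, hx] at h2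
      simpa using h2.symm
    have h3 : ‖C x‖ = ‖C‖ := by
      have : ‖C x‖ ^ 2 = ‖C‖ ^ 2 := by exact_mod_cast h1
      exact (sq_eq_sq₀ (norm_nonneg _) (norm_nonneg _)).1 this
    rw [norm_smul, h3]
    simpa using inv_mul_cancel₀ (norm_pos_iff.2 h0).ne'
  · have h1 : ⟪f i, (‖C‖ : ℂ) • x⟫_ℂ = 0 := by
      rw [← hay, adjoint_inner_right, hf i hi, inner_zero_left]
    rw [inner_smul_right] at h1
    exact (mul_eq_zero.1 h1).resolve_left hne
  · rw [inner_smul_right, ← adjoint_inner_left, hg i hi, inner_zero_left, mul_zero]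

/-- Dependent choice of a sequence in which the condition on the `n`-th term involves only the
preceding terms. -/
theorem exists_seq_of_forall_prefix {α : Type*} [Nonempty α] {P : ℕ → (ℕ → α) → α → Prop}
    (hP : ∀ n p p' a, (∀ i < n, p i = p' i) → P n p a → P n p' a)
    (h : ∀ n p, (∀ i < n, P i p (p i)) → ∃ a, P n p a) : ∃ p : ℕ → α, ∀ n, P n p (p n) := by
  classical
  have h' : ∀ n p, ∃ a, (∀ i < n, P i p (p i)) → P n p a := fun n p => by
    by_cases hp : ∀ i < n, P i p (p i)
    · exact (h n p hp).imp fun a ha _ => ha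
    · exact ⟨Classical.arbitrary α, fun hp' => absurd hp' hp⟩
  choose step hstep using h'
  let p : ℕ → α := wellFounded_lt.fix (C := fun _ => α) fun n prev =>
    step n fun i => if hi : i < n then prev i hi else Classical.arbitrary α
  have hp : ∀ n, p n = step n fun i => if i < n then p i else Classical.arbitrary α := fun n => by
    simp only [p]
    rw [WellFounded.fix_eq]
    simp only [dite_eq_ite]
  refine ⟨p, fun n => ?_⟩
  induction n using Nat.strong_induction_on with
  | _ n ih =>
    rw [hp n]
    refine hP n (fun i => if i < n then p i else Classical.arbitrary α) p _
      (fun i hi => if_pos hi) (hstep n _ fun i hi => ?_)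
    simp only [if_pos hi]
    exact hP i p _ _ (fun j hj => (if_pos (hj.trans hi)).symm) (ih i hi)

open ContinuousLinearMap in
/-- Every compact operator between infinite-dimensional Hilbert spaces has a Schmidt decomposition:
leading pairs of singular vectors are split off one after the other. -/
theorem exists_isSchmidtDecomposition (hX : ¬ FiniteDimensional ℂ X)
    (hY : ¬ FiniteDimensional ℂ Y) {C : X →L[ℂ] Y} (hC : IsCompactOperator C) :
    ∃ s f g, IsSchmidtDecomposition C s f g := by
  -- the residual operator after splitting off the first `n` pairs of `p`
  let R : ℕ → (ℕ → X × Y) → X →L[ℂ] Y := fun n p =>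
    C - ∑ i ∈ Finset.range n, InnerProductSpace.rankOne ℂ (C (p i).1) (p i).1
  have hRcongr : ∀ n p p', (∀ i < n, p i = p' i) → R n p = R n p' := fun n p p' h => by
    simp only [R]
    congr 1
    exact Finset.sum_congr rfl fun i hi => by rw [h i (Finset.mem_range.1 hi)]
  have hRapply : ∀ n p x, (∀ i < n, ⟪(p i).1, x⟫_ℂ = 0) → R n p x = C x := fun n p x h => by
    simp only [R, sub_apply, sum_apply, InnerProductSpace.rankOne_apply]
    rw [Finset.sum_eq_zero fun i hi => by rw [h i (Finset.mem_range.1 hi), zero_smul], sub_zero]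
  have hRadj : ∀ n p y, adjoint (R n p) y =
      adjoint C y - ∑ i ∈ Finset.range n, ⟪C (p i).1, y⟫_ℂ • (p i).1 := fun n p y => by
    simp [R, map_sub, map_sum, sum_apply]
  have hRcpt : ∀ n p, IsCompactOperator (R n p) := fun n p => by
    have : R n p = C ∘L (ContinuousLinearMap.id ℂ X -
        ∑ i ∈ Finset.range n, InnerProductSpace.rankOne ℂ (p i).1 (p i).1) := by
      ext x
      simp [R, sum_apply]
    rw [this]
    exact hC.comp_clm _
  obtain ⟨p, hp⟩ := exists_seq_of_forall_prefix (α := X × Y)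
    (P := fun n p a => ‖a.1‖ = 1 ∧ ‖a.2‖ = 1 ∧ C a.1 = (‖R n p‖ : ℂ) • a.2 ∧
      adjoint C a.2 = (‖R n p‖ : ℂ) • a.1 ∧ (∀ i < n, ⟪(p i).1, a.1⟫_ℂ = 0) ∧
        ∀ i < n, ⟪(p i).2, a.2⟫_ℂ = 0)
    (fun n p p' a h ha => by
      rw [hRcongr n p p' h] at ha
      exact ⟨ha.1, ha.2.1, ha.2.2.1, ha.2.2.2.1, fun i hi => h i hi ▸ ha.2.2.2.2.1 i hi,
        fun i hi => h i hi ▸ ha.2.2.2.2.2 i hi⟩)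
    (fun n p hp => by
      have hof : ∀ i < n, ∀ j < n, i ≠ j → ⟪(p i).1, (p j).1⟫_ℂ = 0 := fun i hi j hj hij => by
        rcases lt_or_gt_of_ne hij with h | h
        · exact (hp j hj).2.2.2.2.1 i h
        · exact inner_eq_zero_symm.1 ((hp i hi).2.2.2.2.1 j h)
      have hog : ∀ i < n, ∀ j < n, i ≠ j → ⟪(p i).2, (p j).2⟫_ℂ = 0 := fun i hi j hj hij => by
        rcases lt_or_gt_of_ne hij with h | h
        · exact (hp j hj).2.2.2.2.2 i h
        · exact inner_eq_zero_symm.1 ((hp i hi).2.2.2.2.2 j h)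
      obtain ⟨x, y, hx, hy, h1, h2, h3, h4⟩ := exists_singular_pair hX hY (hRcpt n p)
        (fun i => (p i).1) (fun i => (p i).2) n
        (fun j hj => by
          simp only [R, sub_apply, sum_apply, InnerProductSpace.rankOne_apply]
          rw [Finset.sum_eq_single_of_mem j (Finset.mem_range.2 hj) fun i hi hij => by
              rw [hof i (Finset.mem_range.1 hi) j hj hij, zero_smul],
            inner_self_eq_norm_sq_to_K, (hp j hj).1]
          simp)
        (fun j hj => by
          rw [hRadj, Finset.sum_eq_single_of_mem j (Finset.mem_range.2 hj) fun i hi hij => by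
              rw [(hp i (Finset.mem_range.1 hi)).2.2.1, inner_smul_left,
                hog i (Finset.mem_range.1 hi) j hj hij, mul_zero, zero_smul],
            (hp j hj).2.2.1, (hp j hj).2.2.2.1, inner_smul_left, inner_self_eq_norm_sq_to_K,
            (hp j hj).2.1]
          simp)
      refine ⟨(x, y), hx, hy, ?_, ?_, h3, h4⟩
      · rw [← h1, hRapply n p x h3]
      · rw [← h2, hRadj, Finset.sum_eq_zero, sub_zero]
        intro i hi
        rw [(hp i (Finset.mem_range.1 hi)).2.2.1, inner_smul_left, h4 i (Finset.mem_range.1 hi),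
          mul_zero, zero_smul])
  have hof : ∀ i j, i ≠ j → ⟪(p i).1, (p j).1⟫_ℂ = 0 := fun i j hij => by
    rcases lt_or_gt_of_ne hij with h | h
    · exact (hp j).2.2.2.2.1 i h
    · exact inner_eq_zero_symm.1 ((hp i).2.2.2.2.1 j h)
  have hog : ∀ i j, i ≠ j → ⟪(p i).2, (p j).2⟫_ℂ = 0 := fun i j hij => by
    rcases lt_or_gt_of_ne hij with h | h
    · exact (hp j).2.2.2.2.2 i h
    · exact inner_eq_zero_symm.1 ((hp i).2.2.2.2.2 j h)
  have hanti : Antitone fun n => ‖R n p‖ := fun n m hnm => by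
    have h1 : ‖C (p m).1‖ = ‖R m p‖ := by
      rw [(hp m).2.2.1, norm_smul, (hp m).2.1]
      simp
    have h2 := (R n p).le_opNorm (p m).1
    rwa [hRapply n p _ fun i hi => (hp m).2.2.2.2.1 i (hi.trans_le hnm), h1, (hp m).1,
      mul_one] at h2
  have hlim : Tendsto (fun n => ‖R n p‖) atTop (𝓝 0) := by
    have hconv := tendsto_atTop_ciInf hanti ⟨0, by rintro _ ⟨n, rfl⟩; exact norm_nonneg _⟩
    obtain ⟨K, hKc, hKs⟩ := hC.image_closedBall_subset_compact (𝕜₁ := ℂ) 1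
    obtain ⟨y, -, φ, hφ, hy⟩ := hKc.tendsto_subseq (x := fun n => C (p n).1)
      fun n => hKs ⟨(p n).1, by simp [(hp n).1], rfl⟩
    have h1 := (hy.sub (hy.comp (tendsto_add_atTop_nat 1))).norm
    rw [sub_self, norm_zero] at h1
    -- the images of distinct unit vectors of the system are orthogonal
    have h2 : ∀ n, ‖R (φ n) p‖ ≤ ‖C (p (φ n)).1 - C (p (φ (n + 1))).1‖ := fun n => by
      have h3 : ⟪C (p (φ n)).1, C (p (φ (n + 1))).1⟫_ℂ = 0 := by
        rw [(hp _).2.2.1, (hp _).2.2.1, inner_smul_left, inner_smul_right,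
          hog _ _ (hφ n.lt_succ_self).ne, mul_zero, mul_zero]
      have h4 := norm_sub_sq (𝕜 := ℂ) (C (p (φ n)).1) (C (p (φ (n + 1))).1)
      have h5 : ‖C (p (φ n)).1‖ = ‖R (φ n) p‖ := by
        rw [(hp _).2.2.1, norm_smul, (hp _).2.1]
        simp
      rw [h3, h5] at h4
      refine le_of_sq_le_sq ?_ (norm_nonneg _)
      rw [h4]
      simp
    have h6 := squeeze_zero (fun n => norm_nonneg _) h2 h1
    rwa [tendsto_nhds_unique (hconv.comp hφ.tendsto_atTop) h6] at hconv
  refine ⟨fun n => ‖R n p‖, fun n => (p n).1, fun n => (p n).2, fun n => norm_nonneg _, hanti, hlim,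
    ⟨fun n => (hp n).1, fun i j hij => hof i j hij⟩,
    ⟨fun n => (hp n).2.1, fun i j hij => hog i j hij⟩, ?_⟩
  rw [tendsto_iff_norm_sub_tendsto_zero]
  refine hlim.congr fun n => ?_
  rw [norm_sub_rev]
  congr 2
  refine Finset.sum_congr rfl fun i _ => ?_
  rw [(hp i).2.2.1]
  simp

end Existence

/-! ### The trace inequality -/

section Trace

variable {X : Type u} {Y : Type v} [NormedAddCommGroup X] [InnerProductSpace ℂ X]
  [NormedAddCommGroup Y] [InnerProductSpace ℂ Y]

/-- Bessel's inequality for finite sums, with the inner products in the other order. -/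
theorem sum_norm_inner_sq_le' {ι : Type*} {e : ι → X} (he : Orthonormal ℂ e) (x : X)
    (S : Finset ι) : ∑ i ∈ S, ‖⟪x, e i⟫_ℂ‖ ^ 2 ≤ ‖x‖ ^ 2 := by
  simpa only [norm_inner_symm] using he.sum_inner_products_le x (s := S)

/-- The norm of a combination of orthonormal vectors with coefficients from Bessel's inequality. -/
theorem norm_sum_inner_smul_le {ι : Type*} {φ ψ : ι → Y} (hφ : Orthonormal ℂ φ)
    (hψ : Orthonormal ℂ ψ) (S : Finset ι) (y : Y) : ‖∑ i ∈ S, ⟪ψ i, y⟫_ℂ • φ i‖ ^ 2 ≤ ‖y‖ ^ 2 := by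
  have h1 := hφ.inner_sum (fun i => ⟪ψ i, y⟫_ℂ) (fun i => ⟪ψ i, y⟫_ℂ) S
  rw [inner_self_eq_norm_sq_to_K] at h1
  simp_rw [Complex.conj_mul'] at h1
  have h2 : ‖∑ i ∈ S, ⟪ψ i, y⟫_ℂ • φ i‖ ^ 2 = ∑ i ∈ S, ‖⟪ψ i, y⟫_ℂ‖ ^ 2 := by
    apply Complex.ofReal_injective
    push_cast
    exact h1
  rw [h2]
  exact hψ.sum_inner_products_le y

theorem _root_.Orthonormal.map_unitary [CompleteSpace X] {ι : Type*} {e : ι → X}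
    (he : Orthonormal ℂ e) (U : unitary (X →L[ℂ] X)) :
    Orthonormal ℂ fun i => (U : X →L[ℂ] X) (e i) :=
  ⟨fun i => by rw [Unitary.norm_map, he.1 i], fun i j hij => by
    simp only [Unitary.inner_map_map, he.2 hij]⟩

/-- The partial sum of a Schmidt series. -/
noncomputable def schmidtPartialSum (s : ℕ → ℝ) (f : ℕ → X) (g : ℕ → Y) (N : ℕ) : X →L[ℂ] Y :=
  ∑ n ∈ Finset.range N, (s n : ℂ) • InnerProductSpace.rankOne ℂ (g n) (f n)

theorem schmidtPartialSum_apply (s : ℕ → ℝ) (f : ℕ → X) (g : ℕ → Y) (N : ℕ) (x : X) :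
    schmidtPartialSum s f g N x = ∑ n ∈ Finset.range N, ((s n : ℂ) * ⟪f n, x⟫_ℂ) • g n := by
  simp [schmidtPartialSum, mul_smul]

/-- The finite-rank form of the trace inequality. Its left-hand side equals
`∑ n k, s n * t k * ⟪f n, U (k k)⟫ * ⟪h k, D (g n)⟫` with the contraction
`D = ∑ i ∈ S, ⟪ψ i, ·⟫ χ i`, and by `|a b| ≤ (|a|² + |b|²) / 2` and Bessel's inequality the weights
are dominated by the mean of two doubly substochastic matrices. The number `δ` measures by how much
the rows `0, …, m` of the first one fail to be stochastic. -/
theorem norm_sum_inner_schmidtPartialSum_le {s t : ℕ → ℝ} {f e : ℕ → X} {g h : ℕ → Y}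
    (hs : Antitone s) (hs0 : ∀ n, 0 ≤ s n) (ht : Antitone t) (ht0 : ∀ n, 0 ≤ t n)
    (hf : Orthonormal ℂ f) (hg : Orthonormal ℂ g) (he : Orthonormal ℂ e) (hh : Orthonormal ℂ h)
    {ι : Type*} {ψ χ : ι → Y} (hψ : Orthonormal ℂ ψ) (hχ : Orthonormal ℂ χ) (S : Finset ι)
    {m N : ℕ} (hmN : m < N) {δ : ℝ}
    (hδ : ∑ n ∈ Finset.range (m + 1), ∑ k ∈ Finset.range N, ‖⟪f n, e k⟫_ℂ‖ ^ 2 ≤ m + 1 - δ) :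
    ‖∑ i ∈ S, ⟪ψ i, schmidtPartialSum s f g N (schmidtPartialSum t h e N (χ i))⟫_ℂ‖ ≤
      ∑ j ∈ Finset.range N, s j * t j - (s m - s (m + 1)) * t (m + 1) * δ / 2 := by
  let w : ℕ → Y := fun n => ∑ i ∈ S, ⟪ψ i, g n⟫_ℂ • χ i
  let w' : ℕ → Y := fun k => ∑ i ∈ S, ⟪χ i, h k⟫_ℂ • ψ i
  have hww : ∀ n k, ⟪h k, w n⟫_ℂ = ⟪w' k, g n⟫_ℂ := fun n k => by
    simp only [w, w', inner_sum, sum_inner, inner_smul_left, inner_smul_right, inner_conj_symm]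
    exact Finset.sum_congr rfl fun i _ => mul_comm _ _
  have hw : ∀ n, ‖w n‖ ^ 2 ≤ 1 := fun n => by
    have := norm_sum_inner_smul_le hχ hψ S (g n)
    rwa [hg.1 n, one_pow] at this
  have hw' : ∀ k, ‖w' k‖ ^ 2 ≤ 1 := fun k => by
    have := norm_sum_inner_smul_le hψ hχ S (h k)
    rwa [hh.1 k, one_pow] at this
  have hexp : ∑ i ∈ S, ⟪ψ i, schmidtPartialSum s f g N (schmidtPartialSum t h e N (χ i))⟫_ℂ =
      ∑ n ∈ Finset.range N, ∑ k ∈ Finset.range N,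
        ((s n * t k : ℝ) : ℂ) * (⟪f n, e k⟫_ℂ * ⟪h k, w n⟫_ℂ) := by
    simp only [schmidtPartialSum_apply, inner_sum, inner_smul_right, w, Finset.mul_sum,
      Finset.sum_mul]
    rw [Finset.sum_comm]
    refine Finset.sum_congr rfl fun n _ => ?_
    rw [Finset.sum_comm]
    refine Finset.sum_congr rfl fun k _ => Finset.sum_congr rfl fun i _ => ?_
    push_cast
    ring
  have hα := sum_sum_mul_le_of_substochastic (α := fun n k => ‖⟪f n, e k⟫_ℂ‖ ^ 2) hs hs0 ht ht0
    hmN (fun n k => by positivity)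
    (fun n => by simpa [hf.1 n] using sum_norm_inner_sq_le' he (f n) (Finset.range N))
    (fun j k => by simpa [he.1 k] using hf.sum_inner_products_le (e k) (s := Finset.range j))
  have hβrow : ∀ n, ∑ k ∈ Finset.range N, ‖⟪h k, w n⟫_ℂ‖ ^ 2 ≤ 1 := fun n =>
    (hh.sum_inner_products_le (w n) (s := Finset.range N)).trans (hw n)
  have hβ := sum_sum_mul_le_of_substochastic (α := fun n k => ‖⟪h k, w n⟫_ℂ‖ ^ 2) hs hs0 ht ht0
    hmN (fun n k => by positivity) hβrow
    (fun j k => by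
      simp only [hww]
      exact (sum_norm_inner_sq_le' hg (w' k) (Finset.range j)).trans (hw' k))
  have hsm : 0 ≤ s m - s (m + 1) := sub_nonneg.2 (hs m.le_succ)
  have hα' : (s m - s (m + 1)) * (t (m + 1) * δ) ≤ (s m - s (m + 1)) * (t (m + 1) *
      (((m + 1 : ℕ) : ℝ) -
        ∑ n ∈ Finset.range (m + 1), ∑ k ∈ Finset.range N, ‖⟪f n, e k⟫_ℂ‖ ^ 2)) := by
    have := ht0 (m + 1)
    gcongr
    push_cast
    linarith
  have hβ' : 0 ≤ (s m - s (m + 1)) * (t (m + 1) * (((m + 1 : ℕ) : ℝ) -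
      ∑ n ∈ Finset.range (m + 1), ∑ k ∈ Finset.range N, ‖⟪h k, w n⟫_ℂ‖ ^ 2)) := by
    refine mul_nonneg hsm (mul_nonneg (ht0 _) (sub_nonneg.2 ?_))
    exact (Finset.sum_le_sum fun n _ => hβrow n).trans (by simp)
  have hbound : ‖∑ n ∈ Finset.range N, ∑ k ∈ Finset.range N,
        ((s n * t k : ℝ) : ℂ) * (⟪f n, e k⟫_ℂ * ⟪h k, w n⟫_ℂ)‖ ≤
      (∑ n ∈ Finset.range N, ∑ k ∈ Finset.range N, s n * t k * ‖⟪f n, e k⟫_ℂ‖ ^ 2 +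
        ∑ n ∈ Finset.range N, ∑ k ∈ Finset.range N, s n * t k * ‖⟪h k, w n⟫_ℂ‖ ^ 2) / 2 := by
    simp only [← Finset.sum_add_distrib, Finset.sum_div]
    refine (norm_sum_le _ _).trans (Finset.sum_le_sum fun n _ =>
      (norm_sum_le _ _).trans (Finset.sum_le_sum fun k _ => ?_))
    have hst := mul_nonneg (hs0 n) (ht0 k)
    rw [norm_mul, norm_mul, Complex.norm_real, Real.norm_of_nonneg hst]
    nlinarith [mul_nonneg hst (sq_nonneg (‖⟪f n, e k⟫_ℂ‖ - ‖⟪h k, w n⟫_ℂ‖))]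
  rw [hexp]
  linarith

/-- The trace inequality of von Neumann, with a loss term that is used to exclude equality. -/
theorem IsSchmidtDecomposition.norm_sum_inner_le_sub [CompleteSpace X] {C : X →L[ℂ] Y}
    {T : Y →L[ℂ] X} {s t : ℕ → ℝ} {f k : ℕ → X} {g h : ℕ → Y} (hC : IsSchmidtDecomposition C s f g)
    (hT : IsSchmidtDecomposition T t h k) (hst : Summable fun j => s j * t j)
    (U : unitary (X →L[ℂ] X)) {ι : Type*} {ψ χ : ι → Y} (hψ : Orthonormal ℂ ψ)
    (hχ : Orthonormal ℂ χ) (S : Finset ι) {m : ℕ} {δ : ℝ}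
    (hδ : ∀ N, ∑ n ∈ Finset.range (m + 1), ∑ j ∈ Finset.range N,
      ‖⟪f n, (U : X →L[ℂ] X) (k j)⟫_ℂ‖ ^ 2 ≤ m + 1 - δ) :
    ‖∑ i ∈ S, ⟪ψ i, C ((U : X →L[ℂ] X) (T (χ i)))⟫_ℂ‖ ≤
      ∑' j, s j * t j - (s m - s (m + 1)) * t (m + 1) * δ / 2 := by
  have hUk := hT.orthonormal_right.map_unitary U
  have hUT : ∀ N, schmidtPartialSum t h (fun n => (U : X →L[ℂ] X) (k n)) N =
      (U : X →L[ℂ] X) ∘L schmidtPartialSum t h k N := fun N => by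
    ext y
    simp [schmidtPartialSum_apply]
  have hlim : ∀ i, Tendsto (fun N => schmidtPartialSum s f g N
      (schmidtPartialSum t h (fun n => (U : X →L[ℂ] X) (k n)) N (χ i))) atTop
        (𝓝 (C ((U : X →L[ℂ] X) (T (χ i))))) := fun i => by
    have h1 := ((U : X →L[ℂ] X).continuous.tendsto _).comp (hT.tendsto_apply (χ i))
    have h2 := ((isBoundedBilinearMap_apply (𝕜 := ℂ) (E := X) (F := Y)).continuous.tendsto
      (C, (U : X →L[ℂ] X) (T (χ i)))).comp (hC.tendsto_sum.prodMk_nhds h1)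
    refine h2.congr fun N => ?_
    rw [hUT, ContinuousLinearMap.comp_apply, schmidtPartialSum_apply t h k N (χ i)]
    rfl
  refine le_of_tendsto (tendsto_finsetSum S fun i _ => tendsto_const_nhds.inner (hlim i)).norm ?_
  filter_upwards [eventually_gt_atTop m] with N hN
  refine (norm_sum_inner_schmidtPartialSum_le hC.antitone hC.nonneg hT.antitone hT.nonneg
    hC.orthonormal_left hC.orthonormal_right hUk hT.orthonormal_left hψ hχ S hN (hδ N)).trans ?_
  have := hst.sum_le_tsum (Finset.range N) fun j _ => mul_nonneg (hC.nonneg j) (hT.nonneg j)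
  linarith

/-- The trace inequality of von Neumann. -/
theorem IsSchmidtDecomposition.norm_sum_inner_le [CompleteSpace X] {C : X →L[ℂ] Y}
    {T : Y →L[ℂ] X} {s t : ℕ → ℝ} {f k : ℕ → X} {g h : ℕ → Y} (hC : IsSchmidtDecomposition C s f g)
    (hT : IsSchmidtDecomposition T t h k) (hst : Summable fun j => s j * t j)
    (U : unitary (X →L[ℂ] X)) {ι : Type*} {ψ χ : ι → Y} (hψ : Orthonormal ℂ ψ)
    (hχ : Orthonormal ℂ χ) (S : Finset ι) :
    ‖∑ i ∈ S, ⟪ψ i, C ((U : X →L[ℂ] X) (T (χ i)))⟫_ℂ‖ ≤ ∑' j, s j * t j := by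
  have h1 := hC.norm_sum_inner_le_sub hT hst U hψ hχ S (m := 0) (δ := 0) fun N => by
    have hUk := hT.orthonormal_right.map_unitary U
    simpa [hC.orthonormal_left.1 0] using sum_norm_inner_sq_le' hUk (f 0) (Finset.range N)
  simpa using h1

theorem IsSchmidtDecomposition.apply_left {C : X →L[ℂ] Y} {s : ℕ → ℝ} {f : ℕ → X} {g : ℕ → Y}
    (hC : IsSchmidtDecomposition C s f g) (n : ℕ) : C (f n) = (s n : ℂ) • g n := by
  refine tendsto_nhds_unique (hC.tendsto_apply (f n)) (tendsto_const_nhds.congr' ?_)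
  filter_upwards [eventually_gt_atTop n] with N hN
  rw [Finset.sum_eq_single_of_mem n (Finset.mem_range.2 hN) fun i _ hi => by
    rw [hC.orthonormal_left.2 hi, mul_zero, zero_smul], inner_self_eq_norm_sq_to_K,
    hC.orthonormal_left.1 n]
  simp

/-- The expansion of `⟪b i, A (b i)⟫` along a Schmidt decomposition is absolutely summable over all
pairs of indices, so that the trace may be computed in any orthonormal basis. -/
theorem IsSchmidtDecomposition.hasSum_inner {A : Y →L[ℂ] Y} {a : ℕ → ℝ} {φ ψ : ℕ → Y}
    (hA : IsSchmidtDecomposition A a φ ψ) (ha : Summable a) {ι : Type*} (b : HilbertBasis ι ℂ Y) :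
    HasSum (fun i => ⟪b i, A (b i)⟫_ℂ) (∑' n, (a n : ℂ) * ⟪φ n, ψ n⟫_ℂ) := by
  let F : ι × ℕ → ℂ := fun x => (a x.2 : ℂ) * (⟪φ x.2, b x.1⟫_ℂ * ⟪b x.1, ψ x.2⟫_ℂ)
  have hcol : ∀ n, HasSum (fun i => F (i, n)) ((a n : ℂ) * ⟪φ n, ψ n⟫_ℂ) := fun n =>
    (b.hasSum_inner_mul_inner (φ n) (ψ n)).mul_left _
  have hnorm : ∀ n i, ‖F (i, n)‖ ≤ a n * ((‖⟪b i, φ n⟫_ℂ‖ ^ 2 + ‖⟪b i, ψ n⟫_ℂ‖ ^ 2) / 2) := by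
    intro n i
    simp only [F, norm_mul, Complex.norm_real, Real.norm_of_nonneg (hA.nonneg n)]
    rw [norm_inner_symm (φ n)]
    refine mul_le_mul_of_nonneg_left ?_ (hA.nonneg n)
    nlinarith [sq_nonneg (‖⟪b i, φ n⟫_ℂ‖ - ‖⟪b i, ψ n⟫_ℂ‖)]
  have hbs : ∀ n, Summable fun i =>
      a n * ((‖⟪b i, φ n⟫_ℂ‖ ^ 2 + ‖⟪b i, ψ n⟫_ℂ‖ ^ 2) / 2) := fun n =>
    (((b.orthonormal.inner_products_summable (φ n)).add
      (b.orthonormal.inner_products_summable (ψ n))).div_const 2).mul_left _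
  have hsum : Summable fun x : ℕ × ι => F x.swap := by
    refine Summable.of_norm ((summable_prod_of_nonneg fun x => norm_nonneg _).2 ⟨fun n =>
      Summable.of_nonneg_of_le (fun i => norm_nonneg _) (hnorm n) (hbs n), ?_⟩)
    refine Summable.of_nonneg_of_le (fun n => tsum_nonneg fun i => norm_nonneg _) (fun n => ?_) ha
    refine ((Summable.of_nonneg_of_le (fun i => norm_nonneg _) (hnorm n) (hbs n)).tsum_le_tsum
      (hnorm n) (hbs n)).trans ?_
    rw [tsum_mul_left, tsum_div_const, Summable.tsum_add
      (b.orthonormal.inner_products_summable _) (b.orthonormal.inner_products_summable _)]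
    have h1 := b.orthonormal.tsum_inner_products_le (φ n)
    have h2 := b.orthonormal.tsum_inner_products_le (ψ n)
    rw [hA.orthonormal_left.1 n] at h1
    rw [hA.orthonormal_right.1 n] at h2
    have h3 := hA.nonneg n
    nlinarith
  have hF : Summable F := (Equiv.prodComm ℕ ι).summable_iff.1 hsum
  have hrow : ∀ i, HasSum (fun n => F (i, n)) ⟪b i, A (b i)⟫_ℂ := fun i => by
    have h1 := (hF.prod_factor i).hasSum
    have h2 : Tendsto (fun N => ∑ n ∈ Finset.range N, F (i, n)) atTop (𝓝 ⟪b i, A (b i)⟫_ℂ) := by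
      refine (tendsto_const_nhds.inner (hA.tendsto_apply (b i))).congr fun N => ?_
      simp only [F, inner_sum, inner_smul_right, mul_assoc]
    rwa [tendsto_nhds_unique h1.tendsto_sum_nat h2] at h1
  have h1 := hsum.hasSum.prod_fiberwise (g := fun n => (a n : ℂ) * ⟪φ n, ψ n⟫_ℂ) hcol
  rw [h1.tsum_eq, show ∑' x : ℕ × ι, F x.swap = ∑' x, F x from (Equiv.prodComm ℕ ι).tsum_eq F]
  exact hF.hasSum.prod_fiberwise hrow

/-- If the sums of `⟪b i, A (b i)⟫` over all orthonormal bases agree, their value is the trace. -/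
theorem trace_eq_of_hasSum [CompleteSpace Y] {A : Y →L[ℂ] Y} {c : ℂ}
    (h : ∀ (ι : Type v) (b : HilbertBasis ι ℂ Y), HasSum (fun i => ⟪b i, A (b i)⟫_ℂ) c) :
    trace A = c :=
  (h _ _).tsum_eq

end Trace

/-! ### Unitary operators with prescribed values -/

section Unitary

variable {H : Type*} [NormedAddCommGroup H] [InnerProductSpace ℂ H] [CompleteSpace H]

open ContinuousLinearMap in
/-- A complex Householder transformation: with `v = x - y`, the operator
`z ↦ z - ⟪v, x⟫⁻¹ ⟪v, z⟫ v` is unitary, sends `x` to `y`, and fixes what is orthogonal to both. -/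
theorem exists_unitary_apply_eq {x y : H} (hx : ‖x‖ = 1) (hy : ‖y‖ = 1) :
    ∃ W : unitary (H →L[ℂ] H), (W : H →L[ℂ] H) x = y ∧
      ∀ z, ⟪x, z⟫_ℂ = 0 → ⟪y, z⟫_ℂ = 0 → (W : H →L[ℂ] H) z = z := by
  by_cases hxy : x = y
  · exact ⟨1, by simpa using hxy, fun z _ _ => by simp⟩
  have hxx : ⟪x, x⟫_ℂ = 1 := by rw [inner_self_eq_norm_sq_to_K, hx]; simp
  have hyy : ⟪y, y⟫_ℂ = 1 := by rw [inner_self_eq_norm_sq_to_K, hy]; simp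
  let v : H := x - y
  let d : ℂ := ⟪v, x⟫_ℂ
  have hd' : star d = ⟪x, v⟫_ℂ := inner_conj_symm x v
  have hvv : ⟪v, v⟫_ℂ = d + star d := by
    rw [hd']
    simp only [d, v, inner_sub_left, inner_sub_right, hxx, hyy]
    ring
  have hd : d ≠ 0 := fun h0 => by
    rw [h0, star_zero, add_zero, inner_self_eq_zero] at hvv
    exact hxy (sub_eq_zero.1 hvv)
  have hds : star d ≠ 0 := star_ne_zero.2 hd
  let W : ℂ → H →L[ℂ] H := fun c => 1 - c • InnerProductSpace.rankOne ℂ v v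
  have hW : ∀ c z, W c z = z - (c * ⟪v, z⟫_ℂ) • v := fun c z => by simp [W, mul_smul]
  have hstar : ∀ c, star (W c) = W (star c) := fun c => by
    simp [W, star_sub, star_smul, star_eq_adjoint]
  have hmul : ∀ c c' : ℂ, c + c' = c * c' * (d + star d) → W c * W c' = 1 := fun c c' h => by
    ext z
    rw [show (W c * W c') z = W c (W c' z) from rfl, hW, hW, inner_sub_right, inner_smul_right, hvv]
    change _ = z
    have : c * (⟪v, z⟫_ℂ - c' * ⟪v, z⟫_ℂ * (d + star d)) + c' * ⟪v, z⟫_ℂ = 0 := by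
      linear_combination ⟪v, z⟫_ℂ * h
    rw [sub_sub, ← add_smul, add_comm, this, zero_smul, sub_zero]
  refine ⟨⟨W d⁻¹, Unitary.mem_iff.2 ⟨?_, ?_⟩⟩, ?_, fun z h1 h2 => ?_⟩
  · rw [hstar]
    refine hmul _ _ ?_
    rw [star_inv₀]
    field_simp
  · rw [hstar]
    refine hmul _ _ ?_
    rw [star_inv₀]
    field_simp
    ring
  · change W d⁻¹ x = y
    rw [hW, show ⟪v, x⟫_ℂ = d from rfl, inv_mul_cancel₀ hd, one_smul]
    simp [v]
  · change W d⁻¹ z = z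
    rw [hW, show ⟪v, z⟫_ℂ = 0 by simp [v, h1, h2]]
    simp

/-- A map between finite orthonormal families extends to a unitary operator. -/
theorem exists_unitary_forall_lt_apply_eq (a b : ℕ → H) (N : ℕ)
    (ha : ∀ i < N, ∀ j < N, ⟪a i, a j⟫_ℂ = if i = j then 1 else 0)
    (hb : ∀ i < N, ∀ j < N, ⟪b i, b j⟫_ℂ = if i = j then 1 else 0) :
    ∃ U : unitary (H →L[ℂ] H), ∀ i < N, (U : H →L[ℂ] H) (a i) = b i := by
  have hnorm : ∀ x : H, ⟪x, x⟫_ℂ = 1 → ‖x‖ = 1 := fun x hx => by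
    have h1 := inner_self_eq_norm_sq (𝕜 := ℂ) x
    rw [hx, RCLike.one_re] at h1
    exact (pow_eq_one_iff_of_nonneg (norm_nonneg x) two_ne_zero).1 h1.symm
  induction N with
  | zero => exact ⟨1, fun i hi => absurd hi (Nat.not_lt_zero i)⟩
  | succ N ih =>
    obtain ⟨U, hU⟩ := ih
      (fun i hi j hj => ha i (hi.trans N.lt_succ_self) j (hj.trans N.lt_succ_self))
      fun i hi j hj => hb i (hi.trans N.lt_succ_self) j (hj.trans N.lt_succ_self)
    have h1 : ‖(U : H →L[ℂ] H) (a N)‖ = 1 := by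
      rw [Unitary.norm_map]
      exact hnorm _ (by simpa using ha N N.lt_succ_self N N.lt_succ_self)
    have h2 : ‖b N‖ = 1 := hnorm _ (by simpa using hb N N.lt_succ_self N N.lt_succ_self)
    obtain ⟨W, hW1, hW2⟩ := exists_unitary_apply_eq h1 h2
    refine ⟨W * U, fun i hi => ?_⟩
    change (W : H →L[ℂ] H) ((U : H →L[ℂ] H) (a i)) = b i
    rcases Nat.lt_succ_iff_lt_or_eq.1 hi with hi' | rfl
    · rw [hU i hi']
      refine hW2 _ ?_ ?_
      · rw [← hU i hi', Unitary.inner_map_map, ha N N.lt_succ_self i hi, if_neg hi'.ne']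
      · rw [hb N N.lt_succ_self i hi, if_neg hi'.ne']
    · exact hW1

end Unitary

/-! ### The trace of `C U T V` -/

section Composition

variable {X : Type u} {Y : Type v} [NormedAddCommGroup X] [InnerProductSpace ℂ X]
  [NormedAddCommGroup Y] [InnerProductSpace ℂ Y]

theorem summable_mul_of_memℓp {p q : ℝ≥0∞} (hpq : p.HolderConjugate q) {s t : ℕ → ℝ}
    (hs : Memℓp s p) (ht : Memℓp t q) : Summable fun j => s j * t j := by
  have h1 : Memℓp (fun j => s j * t j) 1 := Memℓp.holder 1 hs ht
    (fun _ => ContinuousLinearMap.mul ℝ ℝ) (K := 1)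
    fun _ => ContinuousLinearMap.opNorm_mul_le ℝ ℝ
  rw [memℓp_gen_iff (by simp)] at h1
  exact Summable.of_norm (by simpa using h1)

theorem IsSchmidtDecomposition.isCompactOperator [CompleteSpace Y] {C : X →L[ℂ] Y} {s : ℕ → ℝ}
    {f : ℕ → X} {g : ℕ → Y} (hC : IsSchmidtDecomposition C s f g) : IsCompactOperator C := by
  refine isCompactOperator_of_tendsto hC.tendsto_sum (Eventually.of_forall fun N => ?_)
  change _ ∈ compactOperator (RingHom.id ℂ) X Y
  refine Submodule.sum_mem _ fun n _ => Submodule.smul_mem _ _ ?_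
  change IsCompactOperator (InnerProductSpace.rankOne ℂ (g n) (f n))
  rw [InnerProductSpace.rankOne_def']
  have h1 : IsCompactOperator (innerSL ℂ (f n)) := isCompactOperator_of_locallyCompactSpace_dom _
  exact h1.clm_comp (ContinuousLinearMap.toSpanSingleton ℂ (g n))

theorem IsSchmidtDecomposition.inner_apply {C : X →L[ℂ] Y} {s : ℕ → ℝ} {f : ℕ → X} {g : ℕ → Y}
    (hC : IsSchmidtDecomposition C s f g) (n : ℕ) (x : X) :
    ⟪g n, C x⟫_ℂ = (s n : ℂ) * ⟪f n, x⟫_ℂ := by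
  refine tendsto_nhds_unique (tendsto_const_nhds.inner (hC.tendsto_apply x))
    (tendsto_const_nhds.congr' ?_)
  filter_upwards [eventually_gt_atTop n] with N hN
  exact (hC.orthonormal_right.inner_right_sum (fun i => (s i : ℂ) * ⟪f i, x⟫_ℂ)
    (Finset.mem_range.2 hN)).symm

/-- Removing the first `N` terms from a Schmidt decomposition. -/
theorem IsSchmidtDecomposition.sub_partialSum {C : X →L[ℂ] Y} {s : ℕ → ℝ} {f : ℕ → X} {g : ℕ → Y}
    (hC : IsSchmidtDecomposition C s f g) (N : ℕ) :
    IsSchmidtDecomposition (C - schmidtPartialSum s f g N) (fun n => s (n + N))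
      (fun n => f (n + N)) fun n => g (n + N) where
  nonneg n := hC.nonneg _
  antitone _ _ h := hC.antitone (Nat.add_le_add_right h N)
  tendsto_zero := hC.tendsto_zero.comp (tendsto_add_atTop_nat N)
  orthonormal_left := hC.orthonormal_left.comp _ (add_left_injective N)
  orthonormal_right := hC.orthonormal_right.comp _ (add_left_injective N)
  tendsto_sum := by
    refine ((hC.tendsto_sum.comp (tendsto_add_atTop_nat N)).sub_const _).congr fun M => ?_
    rw [Function.comp_apply, add_comm M N, Finset.sum_range_add, schmidtPartialSum,
      add_sub_cancel_left]
    exact Finset.sum_congr rfl fun n _ => by rw [add_comm N n]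

variable [CompleteSpace X] [CompleteSpace Y] {C : X →L[ℂ] Y} {T : Y →L[ℂ] X} {s t : ℕ → ℝ}
  {f k : ℕ → X} {g h : ℕ → Y}

/-- The singular numbers of `C U T V` are summable: the trace inequality is applied to the systems
of a Schmidt decomposition of `C U T V`. -/
theorem IsSchmidtDecomposition.exists_comp (hY : ¬ FiniteDimensional ℂ Y)
    (hC : IsSchmidtDecomposition C s f g) (hT : IsSchmidtDecomposition T t h k)
    (hst : Summable fun j => s j * t j) (U : unitary (X →L[ℂ] X)) (V : unitary (Y →L[ℂ] Y)) :
    ∃ a φ ψ, IsSchmidtDecomposition (C ∘L (U : X →L[ℂ] X) ∘L T ∘L (V : Y →L[ℂ] Y)) a φ ψ ∧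
      Summable a ∧ ∑' n, a n ≤ ∑' j, s j * t j := by
  obtain ⟨a, φ, ψ, hA⟩ := exists_isSchmidtDecomposition hY hY
    (C := C ∘L (U : X →L[ℂ] X) ∘L T ∘L (V : Y →L[ℂ] Y)) (hC.isCompactOperator.comp_clm _)
  have hle : ∀ M, ∑ n ∈ Finset.range M, a n ≤ ∑' j, s j * t j := fun M => by
    have h1 := hC.norm_sum_inner_le hT hst U hA.orthonormal_right
      (hA.orthonormal_left.map_unitary V) (Finset.range M)
    have h2 : ∀ n, ⟪ψ n, C ((U : X →L[ℂ] X) (T ((V : Y →L[ℂ] Y) (φ n))))⟫_ℂ = (a n : ℂ) :=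
      fun n => by
        have h3 := hA.inner_apply n (φ n)
        rw [inner_self_eq_norm_sq_to_K, hA.orthonormal_left.1 n] at h3
        simpa using h3
    simp only [h2] at h1
    rw [← Complex.ofReal_sum, Complex.norm_real,
      Real.norm_of_nonneg (Finset.sum_nonneg fun n _ => hA.nonneg n)] at h1
    exact h1
  exact ⟨a, φ, ψ, hA, summable_of_sum_range_le hA.nonneg hle,
    Real.tsum_le_of_sum_range_le hA.nonneg hle⟩

/-- `C U T V` has a trace, which is bounded by `∑ j, s j * t j`. -/
theorem IsSchmidtDecomposition.exists_hasSum_comp (hY : ¬ FiniteDimensional ℂ Y)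
    (hC : IsSchmidtDecomposition C s f g) (hT : IsSchmidtDecomposition T t h k)
    (hst : Summable fun j => s j * t j) (U : unitary (X →L[ℂ] X)) (V : unitary (Y →L[ℂ] Y)) :
    ∃ c : ℂ, ‖c‖ ≤ ∑' j, s j * t j ∧ ∀ (ι : Type v) (b : HilbertBasis ι ℂ Y),
      HasSum (fun i => ⟪b i, (C ∘L (U : X →L[ℂ] X) ∘L T ∘L (V : Y →L[ℂ] Y)) (b i)⟫_ℂ) c := by
  obtain ⟨a, φ, ψ, hA, ha, hle⟩ := hC.exists_comp hY hT hst U V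
  refine ⟨∑' n, (a n : ℂ) * ⟪φ n, ψ n⟫_ℂ, le_trans ?_ hle, fun ι b => hA.hasSum_inner ha b⟩
  refine tsum_of_norm_bounded ha.hasSum fun n => ?_
  rw [norm_mul, Complex.norm_real, Real.norm_of_nonneg (hA.nonneg n)]
  refine mul_le_of_le_one_right (hA.nonneg n) ((norm_inner_le_norm _ _).trans ?_)
  rw [hA.orthonormal_left.1 n, hA.orthonormal_right.1 n, one_mul]

/-- If `U` maps `k n` to `f n` and `⟪h n, V (g n)⟫ = z` for `n < N`, then `C U T V` is the sum of a
finite-rank operator of trace `z * ∑ n < N, s n * t n` and of the corresponding operator for the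
tails of the two Schmidt decompositions, to which the trace inequality applies. Such a `V` exists
for every `z` in the unit disk because there is room for `V (g n) = z h n + √(1 - |z|²) h (N + n)`. -/
theorem IsSchmidtDecomposition.exists_norm_trace_sub_le (hY : ¬ FiniteDimensional ℂ Y)
    (hC : IsSchmidtDecomposition C s f g) (hT : IsSchmidtDecomposition T t h k)
    (hst : Summable fun j => s j * t j) (N : ℕ) {z : ℂ} (hz : ‖z‖ ≤ 1) :
    ∃ (U : unitary (X →L[ℂ] X)) (V : unitary (Y →L[ℂ] Y)),
      ‖trace (C ∘L (U : X →L[ℂ] X) ∘L T ∘L (V : Y →L[ℂ] Y)) -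
        ∑ n ∈ Finset.range N, ((s n * t n : ℝ) : ℂ) * z‖ ≤ ∑' j, s (j + N) * t (j + N) := by
  obtain ⟨U, hU⟩ := exists_unitary_forall_lt_apply_eq k f N
    (fun i _ j _ => orthonormal_iff_ite.1 hT.orthonormal_right i j)
    (fun i _ j _ => orthonormal_iff_ite.1 hC.orthonormal_left i j)
  let w : ℝ := √(1 - ‖z‖ ^ 2)
  have hw : (starRingEnd ℂ) z * z + (w : ℂ) * w = 1 := by
    have h1 : w * w = 1 - ‖z‖ ^ 2 := Real.mul_self_sqrt (by nlinarith [norm_nonneg z])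
    rw [Complex.conj_mul', ← Complex.ofReal_mul, h1]
    push_cast
    ring
  have hh := orthonormal_iff_ite.1 hT.orthonormal_left
  obtain ⟨V, hV⟩ := exists_unitary_forall_lt_apply_eq g (fun n => z • h n + (w : ℂ) • h (N + n)) N
    (fun i _ j _ => orthonormal_iff_ite.1 hC.orthonormal_right i j)
    (fun i hi j hj => by
      simp only [inner_add_left, inner_add_right, inner_smul_left, inner_smul_right, hh,
        Complex.conj_ofReal]
      rw [if_neg (show i ≠ N + j by omega), if_neg (show N + i ≠ j by omega)]
      by_cases hij : i = j
      · subst hij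
        simpa [mul_comm] using hw
      · simp [hij])
  have hVz : ∀ n < N, ⟪h n, (V : Y →L[ℂ] Y) (g n)⟫_ℂ = z := fun n hn => by
    rw [hV n hn, inner_add_right, inner_smul_right, inner_smul_right, hh, hh, if_pos rfl,
      if_neg (show n ≠ N + n by omega)]
    simp
  obtain ⟨c, hc, hcb⟩ := (hC.sub_partialSum N).exists_hasSum_comp hY (hT.sub_partialSum N)
    ((summable_nat_add_iff N).2 hst) U V
  -- the mixed terms of head and tail vanish, because `U` maps `k n` to `f n` for `n < N`
  have hdecomp : ∀ y, C ((U : X →L[ℂ] X) (T y)) =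
      ∑ n ∈ Finset.range N, ((s n * t n : ℝ) * ⟪h n, y⟫_ℂ) • g n +
        (C - schmidtPartialSum s f g N) ((U : X →L[ℂ] X) ((T - schmidtPartialSum t h k N) y)) := by
    intro y
    have h1 : (U : X →L[ℂ] X) (schmidtPartialSum t h k N y) =
        ∑ n ∈ Finset.range N, ((t n : ℂ) * ⟪h n, y⟫_ℂ) • f n := by
      rw [schmidtPartialSum_apply, map_sum]
      refine Finset.sum_congr rfl fun n hn => ?_
      rw [map_smul, hU n (Finset.mem_range.1 hn)]
    have h2 : schmidtPartialSum s f g N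
        ((U : X →L[ℂ] X) ((T - schmidtPartialSum t h k N) y)) = 0 := by
      rw [schmidtPartialSum_apply]
      refine Finset.sum_eq_zero fun n hn => ?_
      rw [← hU n (Finset.mem_range.1 hn), Unitary.inner_map_map, sub_apply,
        inner_sub_right, hT.inner_apply, schmidtPartialSum_apply,
        hT.orthonormal_right.inner_right_sum (fun i => (t i : ℂ) * ⟪h i, y⟫_ℂ) hn, sub_self,
        mul_zero, zero_smul]
    rw [sub_apply, h2, sub_zero, sub_apply, map_sub,
      map_sub, h1, map_sum]
    have h3 : ∑ n ∈ Finset.range N, C (((t n : ℂ) * ⟪h n, y⟫_ℂ) • f n) =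
        ∑ n ∈ Finset.range N, ((s n * t n : ℝ) * ⟪h n, y⟫_ℂ) • g n := by
      refine Finset.sum_congr rfl fun n _ => ?_
      rw [map_smul, hC.apply_left, smul_smul]
      congr 1
      push_cast
      ring
    rw [h3]
    abel
  have htr : trace (C ∘L (U : X →L[ℂ] X) ∘L T ∘L (V : Y →L[ℂ] Y)) =
      ∑ n ∈ Finset.range N, ((s n * t n : ℝ) : ℂ) * z + c := by
    refine trace_eq_of_hasSum fun ι b => ?_
    have h1 : ∀ n ∈ Finset.range N, HasSum (fun i => ((s n * t n : ℝ) : ℂ) *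
        (⟪h n, (V : Y →L[ℂ] Y) (b i)⟫_ℂ * ⟪b i, g n⟫_ℂ)) (((s n * t n : ℝ) : ℂ) * z) :=
      fun n hn => by
        have h2 := b.hasSum_inner_mul_inner (ContinuousLinearMap.adjoint (V : Y →L[ℂ] Y) (h n))
          (g n)
        simp only [ContinuousLinearMap.adjoint_inner_left, hVz n (Finset.mem_range.1 hn)] at h2
        exact h2.mul_left _
    refine ((hasSum_sum h1).add (hcb ι b)).congr_fun fun i => ?_
    simp only [ContinuousLinearMap.comp_apply]
    rw [hdecomp, inner_add_right, inner_sum]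
    congr 1
    refine Finset.sum_congr rfl fun n _ => ?_
    rw [inner_smul_right, mul_assoc]
  refine ⟨U, V, ?_⟩
  rw [htr, add_sub_cancel_left]
  exact hc

end Composition

/-! ### The closure of the set of traces -/

section Closure

variable {X : Type u} {Y : Type v} [NormedAddCommGroup X] [InnerProductSpace ℂ X]
  [NormedAddCommGroup Y] [InnerProductSpace ℂ Y] [CompleteSpace X] [CompleteSpace Y]
  {C : X →L[ℂ] Y} {T : Y →L[ℂ] X} {s t : ℕ → ℝ} {f k : ℕ → X} {g h : ℕ → Y}

theorem IsSchmidtDecomposition.norm_trace_comp_le (hY : ¬ FiniteDimensional ℂ Y)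
    (hC : IsSchmidtDecomposition C s f g) (hT : IsSchmidtDecomposition T t h k)
    (hst : Summable fun j => s j * t j) (U : unitary (X →L[ℂ] X)) (V : unitary (Y →L[ℂ] Y)) :
    ‖trace (C ∘L (U : X →L[ℂ] X) ∘L T ∘L (V : Y →L[ℂ] Y))‖ ≤ ∑' j, s j * t j := by
  obtain ⟨c, hc, hcb⟩ := hC.exists_hasSum_comp hY hT hst U V
  rwa [trace_eq_of_hasSum hcb]

theorem IsSchmidtDecomposition.closure_traceRange (hY : ¬ FiniteDimensional ℂ Y)
    (hC : IsSchmidtDecomposition C s f g) (hT : IsSchmidtDecomposition T t h k)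
    (hst : Summable fun j => s j * t j) :
    closure (traceRange C T) = Metric.closedBall (0 : ℂ) (∑' j, s j * t j) := by
  refine Set.Subset.antisymm (closure_minimal ?_ Metric.isClosed_closedBall) fun w hw => ?_
  · rintro _ ⟨U, V, rfl⟩
    simpa using hC.norm_trace_comp_le hY hT hst U V
  set r := ∑' j, s j * t j with hr
  have hr0 : 0 ≤ r := tsum_nonneg fun j => mul_nonneg (hC.nonneg j) (hT.nonneg j)
  rw [mem_closedBall_zero_iff] at hw
  -- for `r = 0` the quotient is `0`, which is the right value
  let z : ℂ := w / r
  have hzr : (r : ℂ) * z = w := by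
    rcases hr0.eq_or_lt with h0 | h0
    · have : w = 0 := norm_le_zero_iff.1 (by rwa [h0])
      simp [z, this]
    · have : (r : ℂ) ≠ 0 := by exact_mod_cast h0.ne'
      simp only [z]
      field_simp
  have hz : ‖z‖ ≤ 1 := by
    rw [norm_div, Complex.norm_real, Real.norm_of_nonneg hr0]
    exact div_le_one_of_le₀ hw hr0
  rw [Metric.mem_closure_iff]
  intro ε hε
  obtain ⟨N, hN⟩ := ((tendsto_sum_nat_add fun j => s j * t j).eventually
    (gt_mem_nhds (half_pos hε))).exists
  obtain ⟨U, V, hUV⟩ := hC.exists_norm_trace_sub_le hY hT hst N hz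
  refine ⟨_, ⟨U, V, rfl⟩, ?_⟩
  have htail : ∑ n ∈ Finset.range N, ((s n * t n : ℝ) : ℂ) * z - w =
      -(((∑' j, s (j + N) * t (j + N) : ℝ) : ℂ) * z) := by
    rw [← hzr, ← Finset.sum_mul, ← Complex.ofReal_sum, hr, ← hst.sum_add_tsum_nat_add N]
    push_cast
    ring
  have htail0 : 0 ≤ ∑' j, s (j + N) * t (j + N) :=
    tsum_nonneg fun j => mul_nonneg (hC.nonneg _) (hT.nonneg _)
  have h2 : ‖∑ n ∈ Finset.range N, ((s n * t n : ℝ) : ℂ) * z - w‖ ≤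
      ∑' j, s (j + N) * t (j + N) := by
    rw [htail, norm_neg, norm_mul, Complex.norm_real, Real.norm_of_nonneg htail0]
    exact mul_le_of_le_one_right htail0 hz
  rw [dist_comm, dist_eq_norm]
  have h3 := norm_sub_le_norm_sub_add_norm_sub
    (trace (C ∘L (U : X →L[ℂ] X) ∘L T ∘L (V : Y →L[ℂ] Y)))
    (∑ n ∈ Finset.range N, ((s n * t n : ℝ) : ℂ) * z) w
  linarith

theorem IsSchmidtDecomposition.isLUB_norm_trace (hY : ¬ FiniteDimensional ℂ Y)
    (hC : IsSchmidtDecomposition C s f g) (hT : IsSchmidtDecomposition T t h k)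
    (hst : Summable fun j => s j * t j) :
    IsLUB {r : ℝ | ∃ (U : unitary (X →L[ℂ] X)) (V : unitary (Y →L[ℂ] Y)),
      r = ‖trace (C ∘L (U : X →L[ℂ] X) ∘L T ∘L (V : Y →L[ℂ] Y))‖} (∑' j, s j * t j) := by
  refine ⟨?_, fun c hc => ?_⟩
  · rintro _ ⟨U, V, rfl⟩
    exact hC.norm_trace_comp_le hY hT hst U V
  have hr0 : 0 ≤ ∑' j, s j * t j := tsum_nonneg fun j => mul_nonneg (hC.nonneg j) (hT.nonneg j)
  have h1 : ((∑' j, s j * t j : ℝ) : ℂ) ∈ closure (traceRange C T) := by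
    rw [hC.closure_traceRange hY hT hst, mem_closedBall_zero_iff, Complex.norm_real,
      Real.norm_of_nonneg hr0]
  have h2 : closure (traceRange C T) ⊆ Metric.closedBall 0 c := by
    refine closure_minimal ?_ Metric.isClosed_closedBall
    rintro _ ⟨U, V, rfl⟩
    rw [mem_closedBall_zero_iff]
    exact hc ⟨U, V, rfl⟩
  have h3 := h2 h1
  rwa [mem_closedBall_zero_iff, Complex.norm_real, Real.norm_of_nonneg hr0] at h3

end Closure

/-! ### The supremum need not be attained -/

section NotAttained

theorem memℓp_one_of_summable {s : ℕ → ℝ} (hs : Summable s) : Memℓp s 1 :=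
  memℓp_gen (by simpa using hs.abs)

/-- A summable decreasing sequence and two orthonormal systems form a Schmidt decomposition. -/
theorem exists_isSchmidtDecomposition_of_summable {X : Type u} {Y : Type v}
    [NormedAddCommGroup X] [InnerProductSpace ℂ X] [NormedAddCommGroup Y] [InnerProductSpace ℂ Y]
    [CompleteSpace Y] {s : ℕ → ℝ} {f : ℕ → X} {g : ℕ → Y} (hs : Summable s) (hs0 : ∀ n, 0 ≤ s n)
    (hsa : Antitone s) (hf : Orthonormal ℂ f) (hg : Orthonormal ℂ g) :
    ∃ C : X →L[ℂ] Y, IsSchmidtDecomposition C s f g := by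
  have h1 : Summable fun n => (s n : ℂ) • InnerProductSpace.rankOne ℂ (g n) (f n) := by
    refine Summable.of_norm (hs.congr fun n => ?_)
    rw [norm_smul, InnerProductSpace.norm_rankOne, hf.1 n, hg.1 n, Complex.norm_real,
      Real.norm_of_nonneg (hs0 n), mul_one, mul_one]
  exact ⟨_, hs0, hsa, hs.tendsto_atTop_zero, hf, hg, h1.hasSum.tendsto_sum_nat⟩

/-- Let the system of `C` in its domain be an orthonormal basis `b`, and let the system of `T` in its
range omit the vector `b 0` of this basis. Then the trace stays strictly below its bound: some `⟪b m, U (b 0)⟫` is nonzero, and this is mass that the matrix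
`‖⟪b n, U (b (j + 1))⟫‖ ^ 2` lacks. -/
theorem norm_trace_ne_of_missing_vector {H : Type v} [NormedAddCommGroup H]
    [InnerProductSpace ℂ H] [CompleteSpace H] (hH : ¬ FiniteDimensional ℂ H)
    (b : HilbertBasis ℕ ℂ H) {C T : H →L[ℂ] H} {s t : ℕ → ℝ} {g h : ℕ → H}
    (hC : IsSchmidtDecomposition C s b g)
    (hT : IsSchmidtDecomposition T t h fun n => b (n + 1)) (hst : Summable fun j => s j * t j)
    (hs : StrictAnti s) (ht : ∀ n, 0 < t n) (U V : unitary (H →L[ℂ] H)) :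
    ‖trace (C ∘L (U : H →L[ℂ] H) ∘L T ∘L (V : H →L[ℂ] H))‖ ≠ ∑' j, s j * t j := by
  have hUb := b.orthonormal.map_unitary U
  obtain ⟨m, hm⟩ : ∃ m, ⟪b m, (U : H →L[ℂ] H) (b 0)⟫_ℂ ≠ 0 := by
    by_contra! hcon
    have h1 : b.repr ((U : H →L[ℂ] H) (b 0)) = 0 := by
      ext i
      rw [b.repr_apply_apply, hcon i]
      rfl
    have h2 := hUb.1 0
    simp only at h2
    rw [(map_eq_zero_iff b.repr b.repr.injective).1 h1, norm_zero] at h2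
    exact zero_ne_one h2
  have hpos : 0 < ‖⟪b m, (U : H →L[ℂ] H) (b 0)⟫_ℂ‖ ^ 2 := pow_pos (norm_pos_iff.2 hm) 2
  have hδ : ∀ N, ∑ n ∈ Finset.range (m + 1), ∑ j ∈ Finset.range N,
      ‖⟪b n, (U : H →L[ℂ] H) (b (j + 1))⟫_ℂ‖ ^ 2 ≤
        m + 1 - ‖⟪b m, (U : H →L[ℂ] H) (b 0)⟫_ℂ‖ ^ 2 := fun N => by
    have h1 : ∀ n, ∑ j ∈ Finset.range N, ‖⟪b n, (U : H →L[ℂ] H) (b (j + 1))⟫_ℂ‖ ^ 2 ≤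
        1 - ‖⟪b n, (U : H →L[ℂ] H) (b 0)⟫_ℂ‖ ^ 2 := fun n => by
      have h2 := sum_norm_inner_sq_le' hUb (b n) (Finset.range (N + 1))
      rw [Finset.sum_range_succ', b.orthonormal.1 n] at h2
      linarith
    refine (Finset.sum_le_sum fun n _ => h1 n).trans ?_
    have h3 := Finset.single_le_sum (f := fun n => ‖⟪b n, (U : H →L[ℂ] H) (b 0)⟫_ℂ‖ ^ 2)
      (fun n _ => by positivity) (Finset.self_mem_range_succ m)
    rw [Finset.sum_sub_distrib]
    simp only [Finset.sum_const, Finset.card_range, nsmul_eq_mul, mul_one, Nat.cast_add,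
      Nat.cast_one]
    linarith
  obtain ⟨c, -, hcb⟩ := hC.exists_hasSum_comp hH hT hst U V
  obtain ⟨w, b', -⟩ := exists_hilbertBasis ℂ H
  have hle : ‖c‖ ≤ ∑' j, s j * t j - (s m - s (m + 1)) * t (m + 1) *
      ‖⟪b m, (U : H →L[ℂ] H) (b 0)⟫_ℂ‖ ^ 2 / 2 :=
    le_of_tendsto (hcb w b').norm (Eventually.of_forall fun S =>
      hC.norm_sum_inner_le_sub hT hst U b'.orthonormal (b'.orthonormal.map_unitary V) S hδ)
  have hloss : 0 < (s m - s (m + 1)) * t (m + 1) * ‖⟪b m, (U : H →L[ℂ] H) (b 0)⟫_ℂ‖ ^ 2 / 2 :=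
    half_pos (mul_pos (mul_pos (sub_pos.2 (hs m.lt_succ_self)) (ht _)) hpos)
  rw [trace_eq_of_hasSum hcb]
  exact (hle.trans_lt (sub_lt_self _ hloss)).ne

end NotAttained

end SchattenTrace

theorem mainTheorem1 :
    (∀ (X : Type u) (Y : Type v)
      [NormedAddCommGroup X] [InnerProductSpace ℂ X] [CompleteSpace X]
      [NormedAddCommGroup Y] [InnerProductSpace ℂ Y] [CompleteSpace Y]
      (_hX : ¬ FiniteDimensional ℂ X) (_hY : ¬ FiniteDimensional ℂ Y)
      (p q : ℝ≥0∞) (_hpq : p.HolderConjugate q)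
      (C : X →L[ℂ] Y) (T : Y →L[ℂ] X)
      (_hC : SchattenTrace.IsSchattenClass p C) (_hT : SchattenTrace.IsSchattenClass q T),
      -- all traces involved are well defined
      (∀ (U : unitary (X →L[ℂ] X)) (V : unitary (Y →L[ℂ] Y)),
        SchattenTrace.IsSchattenClass 1 (C ∘L (U : X →L[ℂ] X) ∘L T ∘L (V : Y →L[ℂ] Y)) ∧
        ∀ (ι : Type v) (b : HilbertBasis ι ℂ Y),
          HasSum (fun i => ⟪b i, (C ∘L (U : X →L[ℂ] X) ∘L T ∘L (V : Y →L[ℂ] Y)) (b i)⟫_ℂ)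
            (SchattenTrace.trace (C ∘L (U : X →L[ℂ] X) ∘L T ∘L (V : Y →L[ℂ] Y)))) ∧
      Summable (fun j => SchattenTrace.singularNumber C j * SchattenTrace.singularNumber T j) ∧
      IsLUB {r : ℝ | ∃ (U : unitary (X →L[ℂ] X)) (V : unitary (Y →L[ℂ] Y)),
          r = ‖SchattenTrace.trace (C ∘L (U : X →L[ℂ] X) ∘L T ∘L (V : Y →L[ℂ] Y))‖}
        (∑' j, SchattenTrace.singularNumber C j * SchattenTrace.singularNumber T j) ∧
      closure (SchattenTrace.traceRange C T) =
        Metric.closedBall (0 : ℂ)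
          (∑' j, SchattenTrace.singularNumber C j * SchattenTrace.singularNumber T j)) ∧
    -- the supremum need not be attained
    (∃ C T : ℓ²(ℕ, ℂ) →L[ℂ] ℓ²(ℕ, ℂ),
      (∀ j : ℕ, C (lp.single 2 j (1 : ℂ)) = ((1 : ℂ) / 2 ^ (j + 1)) • lp.single 2 j (1 : ℂ)) ∧
      T (lp.single 2 0 (1 : ℂ)) = 0 ∧
      (∀ j : ℕ, T (lp.single 2 (j + 1) (1 : ℂ)) =
        ((1 : ℂ) / 2 ^ (j + 1)) • lp.single 2 (j + 1) (1 : ℂ)) ∧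
      SchattenTrace.IsSchattenClass 1 C ∧ SchattenTrace.IsSchattenClass ∞ T ∧
      ∀ U V : unitary (ℓ²(ℕ, ℂ) →L[ℂ] ℓ²(ℕ, ℂ)),
        ‖SchattenTrace.trace (C ∘L (U : ℓ²(ℕ, ℂ) →L[ℂ] ℓ²(ℕ, ℂ)) ∘L T ∘L
            (V : ℓ²(ℕ, ℂ) →L[ℂ] ℓ²(ℕ, ℂ)))‖ ≠
          ∑' j, SchattenTrace.singularNumber C j * SchattenTrace.singularNumber T j) := by
  open SchattenTrace in
  refine ⟨fun X Y _ _ _ _ _ _ hX hY p q hpq C T hCp hTq => ?_, ?_⟩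
  · obtain ⟨s, f, g, hC⟩ := exists_isSchmidtDecomposition hX hY hCp.1
    obtain ⟨t, h, k, hT⟩ := exists_isSchmidtDecomposition hY hX hTq.1
    have hs := hCp.2
    have ht := hTq.2
    rw [hC.singularNumber_eq] at hs ⊢
    rw [hT.singularNumber_eq] at ht ⊢
    have hst := summable_mul_of_memℓp hpq hs ht
    refine ⟨fun U V => ⟨?_, fun ι b => ?_⟩, hst, hC.isLUB_norm_trace hY hT hst,
      hC.closure_traceRange hY hT hst⟩
    · obtain ⟨a, φ, ψ, hA, ha, -⟩ := hC.exists_comp hY hT hst U V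
      refine ⟨hA.isCompactOperator, ?_⟩
      rw [hA.singularNumber_eq]
      exact memℓp_one_of_summable ha
    · obtain ⟨c, -, hcb⟩ := hC.exists_hasSum_comp hY hT hst U V
      rw [trace_eq_of_hasSum hcb]
      exact hcb ι b
  · let b : HilbertBasis ℕ ℂ ℓ²(ℕ, ℂ) := ⟨LinearIsometryEquiv.refl ℂ _⟩
    have hb : ∀ j, b j = lp.single 2 j (1 : ℂ) := fun j => (b.repr_symm_single j).symm
    let s : ℕ → ℝ := fun j => 1 / 2 ^ (j + 1)
    have hs0 : ∀ j, 0 < s j := fun j => by positivity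
    have hsa : StrictAnti s := strictAnti_nat_of_succ_lt fun j => by
      simp only [s]
      gcongr
      · norm_num
      · omega
    have hs : Summable s := by
      have h1 := (summable_geometric_two.mul_left (1 / 2 : ℝ))
      refine h1.congr fun j => ?_
      simp only [s, one_div, inv_pow, pow_succ, mul_inv]
      ring
    have hsC : ∀ j, ((s j : ℝ) : ℂ) = (1 : ℂ) / 2 ^ (j + 1) := fun j => by simp [s]
    have hb1 : Orthonormal ℂ fun n => b (n + 1) := b.orthonormal.comp _ (add_left_injective 1)
    obtain ⟨C, hC⟩ := exists_isSchmidtDecomposition_of_summable hs (fun j => (hs0 j).le)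
      hsa.antitone b.orthonormal b.orthonormal
    obtain ⟨T, hT⟩ := exists_isSchmidtDecomposition_of_summable hs (fun j => (hs0 j).le)
      hsa.antitone hb1 hb1
    have hst : Summable fun j => s j * s j := summable_mul_of_memℓp ENNReal.HolderConjugate.one_top
      (memℓp_one_of_summable hs) ((memℓp_one_of_summable hs).of_exponent_ge le_top)
    have hinf : ¬ FiniteDimensional ℂ ℓ²(ℕ, ℂ) := fun hfin =>
      Infinite.not_finite (b.orthonormal.linearIndependent.finite)
    refine ⟨C, T, fun j => ?_, ?_, fun j => ?_, ⟨hC.isCompactOperator, ?_⟩,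
      ⟨hT.isCompactOperator, ?_⟩, fun U V => ?_⟩
    · rw [← hb, hC.apply_left, hsC]
    · rw [← hb]
      refine tendsto_nhds_unique (hT.tendsto_apply (b 0)) (tendsto_const_nhds.congr fun N => ?_)
      refine (Finset.sum_eq_zero fun n _ => ?_).symm
      rw [b.orthonormal.2 n.succ_ne_zero, mul_zero, zero_smul]
    · rw [← hb, hT.apply_left, hsC]
    · rw [hC.singularNumber_eq]
      exact memℓp_one_of_summable hs
    · rw [hT.singularNumber_eq]
      exact (memℓp_one_of_summable hs).of_exponent_ge le_top
    · rw [hC.singularNumber_eq, hT.singularNumber_eq]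
      exact norm_trace_ne_of_missing_vector hinf b hC hT hst hsa hs0 U V
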